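/- **Setting.** Miners $1,\dots,N$ are assigned to $m\ge 1$ shards. Each miner is honest or corrupted, holds a positive share of its shard's hashing power (shares in a shard sum to $1$; $\rho_i$ is the total share of the honest miners of shard $i$), and every shard contains an honest miner. Shard $i$ has network delay $\Delta_i\ge 0$ and exclusive-block rate $\lambda_i>0$; inclusive blocks are mined at rate $\lambda_s\ge 0$ in every shard. Proof-of-work solutions form a homogeneous Poisson process of total rate $\sum_j(\lambda_j+\lambda_s)$ with independent marks (miner, exclusive/inclusive): a miner of shard $j$ with share $q$ finds exclusive solutions at rate $q\lambda_j$ and inclusive ones at rate $q\lambda_s$. In shard $i$, a solution of a miner of the shard gives a *full block*, and an inclusive solution of another shard gives a *light block*; both are called blocks of the shard. **Severe environment in shard $i$.** An honest full block reaches all honest miners exactly $\Delta_i$ after it is mined, and an honest light block at once. While an honest full block is being delivered, honest solutions are void in the shard (adversarial ones are not). Of blocks mined simultaneously only one is kept. **Executions.** Fix a time $\tau$ at which a target transaction $\mathtt{tx}$ becomes available. An execution of the protocol under an attack is a tree of valid blocks rooted at genesis. Every remaining honest solution gives a block; the adversary may leave solutions unused, chooses the parents of its blocks among earlier blocks and which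 of its blocks contain $\mathtt{tx}$, decides when each honest miner sees each adversarial block, and breaks ties for the honest miners. Honest views grow with time, contain genesis and contain the parents of their blocks. An honest block extends a longest chain in its miner's view. Blocks mined up to time $\tau$ do not contain $\mathtt{tx}$; a chain contains $\mathtt{tx}$ at most once; an honest block (full or light) mined after $\tau$ contains $\mathtt{tx}$ unless an earlier block of its chain does. The height of a block is the number of blocks on the chain from genesis to it, and the length of a chain is the height of its last block. **Violation.** A chain is *public* at time $t$ if all honest miners have it in view, and *trustworthy* at $t$ if it has been mined by time $t$ and is at least as long as every chain public at $t$. For $\kappa\ge 1$, a block $b$ is *confirmed* at $t$ if it lies on a chain trustworthy at $t$ of length at least $h_b+\kappa-1$, where $h_b$ is the height of $b$. The consistency of $\mathtt{tx}$ is *violated* if a block containing $\mathtt{tx}$ is confirmed at some time and a different block of the same height (containing $\mathtt{tx}$ or not) is confirmed at some, possibly different, time. **Private-mining attack.** The adversary uses all its solutions and never includes $\mathtt{tx}$. Up to time $\tau$ it always mines on a longest chain among all blocks mined so far. After $\tau$ it extends a private chain that starts from a longest chain mined by time $\tau$ and to which only its own later blocks are appended. It withholds all its blocks until $\mathtt{tx}$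 is confirmed by a trustworthy chain and the private chain is at least as long as that chain; immediately afterwards it publishes the private chain. **Theorem.** For almost every realization of the proof-of-work process, the following holds for every shard $i$, every $\tau\in\mathbb R$ and every $\kappa\ge 1$, where all executions are over the same realization. If some execution, under any attack, in the severe environment of shard $i$ violates the consistency of $\mathtt{tx}$, then private-mining executions exist and every private-mining execution violates the consistency of $\mathtt{tx}$. -/

import Mathlib

open MeasureTheory ProbabilityTheory
open scoped ENNReal

noncomputable section

/-! ### The execution environment and the proof-of-work randomness -/

/-- A sharded execution environment with `m` shards and `N` miners.  The honest ratio of shard `i`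
is the total share of its honest miners. -/
structure Env (m N : ℕ) where
  /-- there is at least one shard -/
  shards_pos : 0 < m
  /-- the shard to which shard formation assigns a miner -/
  shard : Fin N → Fin m
  /-- the miners that are not corrupted -/
  honest : Fin N → Prop
  /-- the fraction of the hashing power of its own shard that a miner holds -/
  share : Fin N → ℝ
  share_pos : ∀ p, 0 < share p
  share_sum : ∀ i, ∑ p with shard p = i, share p = 1
  /-- every shard contains an honest miner -/
  honest_presence : ∀ i, ∃ p, shard p = i ∧ honest p
  /-- mining rate of exclusive blocks in each shard -/
  rateExcl : Fin m → ℝ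
  rateExcl_pos : ∀ i, 0 < rateExcl i
  /-- mining rate of inclusive blocks (the same in every shard) -/
  rateIncl : ℝ
  rateIncl_nonneg : 0 ≤ rateIncl
  /-- maximal network delay of each shard -/
  delay : Fin m → ℝ
  delay_nonneg : ∀ i, 0 ≤ delay i

/-- The mark of a proof-of-work solution: its miner, and whether the block is inclusive (`true`)
or exclusive (`false`). -/
abbrev Mark (N : ℕ) := Fin N × Bool

/-- A sample of the mining process: for each solution, in chronological order, the waiting time
since the previous one and the mark. -/
abbrev Sample (N : ℕ) := ℕ → ℝ × Mark N

namespace Env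

variable {m N : ℕ} (E : Env m N)

/-- Rate at which solutions with a given mark arrive. -/
def markRate (x : Mark N) : ℝ :=
  E.share x.1 * (if x.2 then E.rateIncl else E.rateExcl (E.shard x.1))

/-- Total mining rate of the network. -/
def totalRate : ℝ := ∑ x : Mark N, E.markRate x

lemma markRate_nonneg (x : Mark N) : 0 ≤ E.markRate x := by
  unfold markRate
  refine mul_nonneg (E.share_pos _).le ?_
  split
  · exact E.rateIncl_nonneg
  · exact (E.rateExcl_pos _).le

lemma totalRate_pos : 0 < E.totalRate := by
  obtain ⟨p, -, -⟩ := E.honest_presence ⟨0, E.shards_pos⟩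
  refine Finset.sum_pos' (fun x _ => E.markRate_nonneg x) ⟨(p, false), Finset.mem_univ _, ?_⟩
  simpa [markRate] using mul_pos (E.share_pos p) (E.rateExcl_pos (E.shard p))

lemma tsum_markRate :
    ∑' x : Mark N, ENNReal.ofReal (E.markRate x) = ENNReal.ofReal E.totalRate := by
  rw [tsum_fintype, totalRate, ENNReal.ofReal_sum_of_nonneg fun x _ => E.markRate_nonneg x]

/-- Law of the mark of one solution: proportional to the rates. -/
def markLaw : PMF (Mark N) :=
  PMF.normalize (fun x => ENNReal.ofReal (E.markRate x))
    (by rw [E.tsum_markRate]; exact (ENNReal.ofReal_pos.2 E.totalRate_pos).ne')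
    (by rw [E.tsum_markRate]; exact ENNReal.ofReal_ne_top)

/-- Law of (waiting time, mark) of one solution. -/
def stepLaw : Measure (ℝ × Mark N) := (expMeasure E.totalRate).prod E.markLaw.toMeasure

instance : IsProbabilityMeasure E.stepLaw := by
  have := isProbabilityMeasure_expMeasure E.totalRate_pos
  unfold stepLaw
  infer_instance

/-- The marked homogeneous Poisson process of proof-of-work solutions: independent exponential
waiting times and independent marks.  Equivalently, solutions with different marks form
independent Poisson processes with rates `markRate`. -/
def powLaw : Measure (Sample N) := Measure.infinitePi fun _ : ℕ => E.stepLaw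

end Env

/-- Time at which the `n`-th solution is found. -/
def arrivalTime {N : ℕ} (ω : Sample N) (n : ℕ) : ℝ := ∑ k ∈ Finset.range (n + 1), (ω k).1

/-! ### The severe execution environment, seen from one shard -/

/-- The record of the abstract blocks that proof of work yields in one shard. -/
structure Trace (N : ℕ) where
  /-- mining times, in chronological order -/
  time : ℕ → ℝ
  miner : ℕ → Fin N
  /-- the uncorrupted miners -/
  honestMiner : Fin N → Prop
  /-- full blocks (mined inside the shard); the others are light blocks -/
  full : ℕ → Prop
  /-- the solutions that count as abstract blocks of this shard -/
  live : ℕ → Prop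
  /-- network delay of the shard -/
  delay : ℝ

namespace Trace

variable {N : ℕ} (T : Trace N)

/-- Honest (abstract) blocks of the shard. -/
def IsHonest (n : ℕ) : Prop := T.live n ∧ T.honestMiner (T.miner n)

/-- Adversarial (abstract) blocks of the shard. -/
def IsAdversarial (n : ℕ) : Prop := T.live n ∧ ¬ T.honestMiner (T.miner n)

open Classical in
/-- Time at which an honest block reaches all honest miners in the severe environment: a full block
is delayed by exactly the network delay, a light block is not delayed. -/
def deliveryTime (n : ℕ) : ℝ := T.time n + if T.full n then T.delay else 0

end Trace

namespace Env

variable {m N : ℕ} (E : Env m N)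

/-- The `n`-th solution gives a full block of shard `i`: it was found by a miner of the shard. -/
def IsFull (ω : Sample N) (i : Fin m) (n : ℕ) : Prop := E.shard (ω n).2.1 = i

/-- The `n`-th solution gives a light block of shard `i`: it is an inclusive block of another
shard. -/
def IsLight (ω : Sample N) (i : Fin m) (n : ℕ) : Prop :=
  E.shard (ω n).2.1 ≠ i ∧ (ω n).2.2 = true

/-- The solutions that survive the rules of the severe environment in shard `i`:
they extend the chains of the shard (full or light); of several blocks mined at the same time only
one survives (simultaneous solutions are listed in arbitrary order, the first one is kept); and a
solution of an honest miner is void while an honest full block of the shard is being delivered. -/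
def SevereLive (ω : Sample N) (i : Fin m) (n : ℕ) : Prop :=
  (E.IsFull ω i n ∨ E.IsLight ω i n) ∧
    (∀ k, (_ : k < n) → SevereLive ω i k → arrivalTime ω k ≠ arrivalTime ω n) ∧
    (E.honest (ω n).2.1 → ∀ k, (_ : k < n) → SevereLive ω i k →
      E.honest (ω k).2.1 → E.IsFull ω i k → arrivalTime ω k + E.delay i < arrivalTime ω n)
termination_by n

/-- The abstract blocks of shard `i` in the severe execution environment. -/
def severeTrace (ω : Sample N) (i : Fin m) : Trace N where
  time := arrivalTime ω
  miner n := (ω n).2.1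
  honestMiner := E.honest
  full := E.IsFull ω i
  live := E.SevereLive ω i
  delay := E.delay i

end Env

/-! ### Block trees -/

/-- A block: `none` is the genesis block, `some n` the block made from the `n`-th solution. -/
abbrev Block := Option ℕ

/-- Parent pointers; a parent comes earlier than its child. -/
structure BlockTree where
  parent : ℕ → Block
  parent_lt : ∀ n k, parent n = some k → k < n

namespace BlockTree

variable (B : BlockTree)

/-- Height of the `n`-th mined block. -/
def minedHeight (n : ℕ) : ℕ :=
  match _h : B.parent n with
  | none => 2
  | some k => minedHeight k + 1
termination_by n
decreasing_by exact B.parent_lt n k _h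

/-- Height of a block: the number of blocks on the chain from genesis to it.  A chain is identified
with its last block, so this is also the length of a chain. -/
def height : Block → ℕ
  | none => 1
  | some n => B.minedHeight n

/-- `OnChain a c`: the chain ending in `c` contains the block `a`. -/
inductive OnChain : Block → Block → Prop
  | refl (a : Block) : OnChain a a
  | step (a : Block) (n : ℕ) : OnChain a (B.parent n) → OnChain a (some n)

end BlockTree

/-! ### Attacks, and violation of consistency -/

/-- A run of the protocol in one shard against some attack, for a target transaction `tx` that
becomes available to the miners at time `τ`.  The adversary decides which of its solutions become
valid blocks, the parents of its blocks, which of its blocks contain `tx`, when each honest miner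
sees each adversarial block, and how honest miners break ties. -/
structure Execution {N : ℕ} (T : Trace N) (τ : ℝ) extends BlockTree where
  /-- the valid blocks of the run; adversarial solutions may be left unused -/
  mined : Set ℕ
  mined_live : ∀ n ∈ mined, T.live n
  honest_mined : ∀ n, T.IsHonest n → n ∈ mined
  parent_mined : ∀ n ∈ mined, ∀ k, parent n = some k → k ∈ mined
  /-- the blocks that contain `tx` -/
  hasTx : Set ℕ
  hasTx_mined : ∀ n ∈ hasTx, n ∈ mined ∧ τ < T.time n
  /-- a valid chain contains `tx` at most once -/
  hasTx_once : ∀ n ∈ hasTx, ∀ a, toBlockTree.OnChain (some a) (parent n) → a ∉ hasTx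
  /-- honest miners include `tx`, once available, unless their chain contains it already -/
  hasTx_honest : ∀ n, T.IsHonest n → τ < T.time n →
    (∀ a, toBlockTree.OnChain (some a) (parent n) → a ∉ hasTx) → n ∈ hasTx
  /-- the blocks that a miner has seen at a time (meaningful for honest miners) -/
  view : Fin N → ℝ → Set Block
  genesis_view : ∀ j, T.honestMiner j → ∀ t, none ∈ view j t
  view_mined : ∀ j, T.honestMiner j → ∀ t n, some n ∈ view j t → n ∈ mined ∧ T.time n ≤ t
  view_mono : ∀ j, T.honestMiner j → ∀ s t, s ≤ t → view j s ⊆ view j t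
  view_parent : ∀ j, T.honestMiner j → ∀ t n, some n ∈ view j t → parent n ∈ view j t
  /-- honest blocks are seen by all honest miners from their delivery time on, not before -/
  view_honest : ∀ j, T.honestMiner j → ∀ n, T.IsHonest n → ∀ t,
    some n ∈ view j t ↔ T.deliveryTime n ≤ t
  /-- longest chain rule: an honest block extends a longest chain in the view of its miner -/
  honest_parent : ∀ n, T.IsHonest n →
    parent n ∈ view (T.miner n) (T.time n) ∧
      ∀ b ∈ view (T.miner n) (T.time n), b ≠ some n →
        toBlockTree.height b ≤ toBlockTree.height (parent n)

namespace Execution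

variable {N : ℕ} {T : Trace N} {τ : ℝ} (X : Execution T τ)

/-- The block exists by time `t`. -/
def MinedBy (t : ℝ) (b : Block) : Prop := ∀ n, b = some n → n ∈ X.mined ∧ T.time n ≤ t

/-- The block, hence the chain ending in it, is in the view of all honest miners. -/
def Public (t : ℝ) (b : Block) : Prop := ∀ j, T.honestMiner j → b ∈ X.view j t

/-- The chain ending in `c` is trustworthy at time `t`: it is at least as long as any public
chain. -/
def Trustworthy (t : ℝ) (c : Block) : Prop :=
  X.MinedBy t c ∧ ∀ b, X.Public t b → X.height b ≤ X.height c

/-- The block `b` is confirmed at time `t` by the chain ending in `c`: the chain is trustworthy,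
contains `b`, and has length at least `height b + κ - 1`. -/
def ConfirmedBy (κ : ℕ) (t : ℝ) (b c : Block) : Prop :=
  X.Trustworthy t c ∧ X.OnChain b c ∧ X.height b + κ ≤ X.height c + 1

/-- The consistency of `tx` is violated: a block containing `tx` is confirmed, and so is another
block at the same height. -/
def ViolatesConsistency (κ : ℕ) : Prop :=
  ∃ n ∈ X.hasTx, ∃ (b c d : Block) (t t' : ℝ), b ≠ some n ∧ X.height b = X.height (some n) ∧
    X.ConfirmedBy κ t (some n) c ∧ X.ConfirmedBy κ t' b d

end Execution

/-! ### The private-mining attack -/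

/-- The adversarial blocks of the race phase: those mined after time `τ`. -/
def Trace.raceBlocks {N : ℕ} (T : Trace N) (τ : ℝ) : Set ℕ :=
  {n | T.IsAdversarial n ∧ τ < T.time n}

/-- `p` is the tip of the private chain that starts from `g` and to which the blocks in `S` have
been appended in chronological order. -/
def IsPrivateTip (g : Block) (S : Set ℕ) (p : Block) : Prop :=
  (S = ∅ ∧ p = g) ∨ ∃ k, IsGreatest S k ∧ p = some k

/-- `p` is the tip of the private chain at time `t`; `g` is the block at which the race started. -/
def Trace.PrivateTipAt {N : ℕ} (T : Trace N) (τ : ℝ) (g : Block) (t : ℝ) (p : Block) : Prop :=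
  IsPrivateTip g {k ∈ T.raceBlocks τ | T.time k ≤ t} p

namespace Execution

variable {N : ℕ} {T : Trace N} {τ : ℝ} (X : Execution T τ)

/-- The event on which the private chain is published at time `t`: the target transaction is
confirmed by a trustworthy chain, and the private chain is at least as long. -/
def PublishEvent (κ : ℕ) (g : Block) (t : ℝ) : Prop :=
  ∃ n ∈ X.hasTx, ∃ c p, X.ConfirmedBy κ t (some n) c ∧ T.PrivateTipAt τ g t p ∧
    X.height c ≤ X.height p

/-- The adversary follows the private-mining attack, with the race starting from block `g`. -/
structure FollowsPrivateMining (κ : ℕ) (g : Block) : Prop where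
  /-- the adversary uses all its solutions -/
  uses_all : ∀ n, T.IsAdversarial n → n ∈ X.mined
  /-- cheating phase: up to time `τ` the adversary mines on a longest chain -/
  cheating : ∀ n, T.IsAdversarial n → T.time n ≤ τ →
    ∀ k ∈ X.mined, k < n → X.height (some k) ≤ X.height (X.parent n)
  /-- the race starts from a longest chain mined by time `τ` -/
  race_start : X.MinedBy τ g ∧ ∀ b, X.MinedBy τ b → X.height b ≤ X.height g
  /-- race phase: after time `τ` the adversary extends its private chain -/
  race : ∀ n ∈ T.raceBlocks τ, IsPrivateTip g (T.raceBlocks τ ∩ Set.Iio n) (X.parent n)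
  /-- the adversary excludes the target transaction -/
  excludes : ∀ n, T.IsAdversarial n → n ∉ X.hasTx
  /-- the adversary's blocks are withheld as long as the publishing event has not occurred -/
  withholds : ∀ j, T.honestMiner j → ∀ t n, T.IsAdversarial n → some n ∈ X.view j t →
    ∃ s < t, X.PublishEvent κ g s
  /-- upon the publishing event the private chain is published -/
  publishes : ∀ s p, X.PublishEvent κ g s → T.PrivateTipAt τ g s p → ∀ t > s, X.Public t p

/-- The adversary follows the private-mining attack. -/
def IsPrivateMining (κ : ℕ) : Prop := ∃ g, X.FollowsPrivateMining κ g

end Execution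

end

/-!
The comparison of attacks is pathwise.  Almost surely the solutions of the mining process do not
accumulate and the honest miners of every shard keep finding solutions (second Borel-Cantelli
lemma, `Env.ae_frequently_honest`), so the severe environment satisfies `Trace.IsSevere`: an honest block
is delivered before the next one is mined, and honest blocks never cease.  Consequently, in every
execution, honest blocks have strictly increasing heights, hence at most one honest block at each
height.

Let `L` be the lead at time `τ`: the walk that goes up with each adversarial block, and down, but
not below zero, with each honest one.  Under any attack the longest chain at time `τ` exceeds the
honest chain, of height `y` say, by at most `L`
(`Execution.height_le_honestHeight_add_lead`), whereas private mining exceeds it by `L`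
(`Execution.FollowsPrivateMining.honestCount_add_lead_le_height`).

Suppose that two conflicting chains violate the consistency of `tx`.  At heights from the block with
`tx` upwards they have two different blocks, one of which is adversarial.  Below that block, the
chain with `tx` contains no honest block mined after `τ`, since such a block would contain `tx` too.
Hence all heights above `y + L` that both chains reach carry adversarial blocks mined after `τ`.
The longest chain rule allows the later chain to be cut so that the part above the other chain is
adversarial as well (`Execution.exists_trustworthy_truncation`).  Counting heights gives a time at
which `L` plus the number of adversarial blocks mined after `τ` is at least the confirmation depth,
and at least the number of honest blocks mined after `τ` and delivered so far
(`Execution.ViolatesConsistency.exists_race_bounds`).  The bounds persist until the honest miners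
have mined enough blocks to confirm `tx`.

Under private mining the honest blocks form a single chain until the publishing event, so these
bounds say exactly that the private chain catches up with a chain confirming `tx`
(`Execution.FollowsPrivateMining.exists_publishEvent`), and then the private chain confirms a
different block at the height of the block with `tx`.

Private-mining executions are constructed by recursion on the solutions
(`Execution.exists_isPrivateMining`).
-/

/-! ### Chains of a block tree -/

namespace BlockTree

variable {B : BlockTree}

lemma height_none : B.height none = 1 := rfl

lemma height_some (n : ℕ) : B.height (some n) = B.height (B.parent n) + 1 := by
  change B.minedHeight n = _
  rw [minedHeight]
  split <;> rename_i h <;> rw [h] <;> rfl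

lemma one_le_height (b : Block) : 1 ≤ B.height b := by
  cases b with
  | none => exact le_rfl
  | some n => rw [height_some]; omega

lemma OnChain.trans {a b c : Block} (hab : B.OnChain a b) (hbc : B.OnChain b c) :
    B.OnChain a c := by
  induction hbc with
  | refl => exact hab
  | step n _ ih => exact .step _ _ ih

lemma OnChain.height_le {a c : Block} (h : B.OnChain a c) : B.height a ≤ B.height c := by
  induction h with
  | refl => exact le_rfl
  | step n _ ih => rw [height_some]; omega

lemma OnChain.eq_of_height_le {a c : Block} (h : B.OnChain a c)
    (hle : B.height c ≤ B.height a) : a = c := by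
  cases h with
  | refl => rfl
  | step n h' =>
    have := h'.height_le
    rw [height_some] at hle
    omega

lemma OnChain.exists_index_le {k : ℕ} {c : Block} (h : B.OnChain (some k) c) :
    ∃ n, c = some n ∧ k ≤ n := by
  generalize ha : some k = a at h
  induction h with
  | refl => exact ⟨k, ha.symm, le_rfl⟩
  | step n _ ih =>
    obtain ⟨l, hl, hkl⟩ := ih
    exact ⟨n, rfl, hkl.trans (B.parent_lt _ _ hl).le⟩

lemma OnChain.index_lt {k n : ℕ} (h : B.OnChain (some k) (B.parent n)) : k < n := by
  obtain ⟨l, hl, hkl⟩ := h.exists_index_le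
  exact hkl.trans_lt (B.parent_lt _ _ hl)

lemma OnChain.parent_of_ne {a : Block} {n : ℕ} (h : B.OnChain a (some n)) (hne : a ≠ some n) :
    B.OnChain a (B.parent n) := by
  cases h with
  | refl => exact absurd rfl hne
  | step n h' => exact h'

/-- A chain is totally ordered by height. -/
lemma OnChain.of_height_le {a b c : Block} (ha : B.OnChain a c) (hb : B.OnChain b c)
    (h : B.height a ≤ B.height b) : B.OnChain a b := by
  induction hb with
  | refl => exact ha
  | step n hb' ih =>
    by_cases hne : a = some n
    · subst hne
      have := hb'.height_le
      rw [height_some] at h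
      omega
    · exact ih (ha.parent_of_ne hne)

lemma exists_onChain_height (c : Block) {x : ℕ} (hx : 1 ≤ x) (hxc : x ≤ B.height c) :
    ∃ a, B.OnChain a c ∧ B.height a = x := by
  by_cases h : x = B.height c
  · exact ⟨c, .refl c, h.symm⟩
  · cases hc : c with
    | none => subst hc; rw [height_none] at hxc h; omega
    | some n =>
      have hlt : x ≤ B.height (B.parent n) := by
        rw [hc, height_some] at hxc h; omega
      have : ∀ n, x ≤ B.height (B.parent n) → ∃ a, B.OnChain a (some n) ∧ B.height a = x := by
        intro n
        induction n using Nat.strong_induction_on with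
        | _ n ih =>
          intro hn
          by_cases he : x = B.height (B.parent n)
          · exact ⟨_, .step _ _ (.refl _), he.symm⟩
          · cases hp : B.parent n with
            | none => rw [hp, height_none] at hn he; omega
            | some k =>
              obtain ⟨a, ha, hax⟩ := ih k (B.parent_lt _ _ hp)
                (by rw [hp, height_some] at hn he; omega)
              exact ⟨a, .step _ _ (hp ▸ ha), hax⟩
      exact this n hlt

end BlockTree

/-! ### Traces of the severe environment -/

namespace Trace

variable {N : ℕ} (T : Trace N)

/-- The pathwise properties of the severe environment on which the comparison of attacks rests:
solutions do not accumulate, each honest block is delivered before the next honest block is mined,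
and honest blocks never cease. -/
structure IsSevere : Prop where
  time_strictMono : StrictMono T.time
  time_unbounded : ∀ t, ∃ n, t < T.time n
  time_le_deliveryTime : ∀ n, T.time n ≤ T.deliveryTime n
  deliveryTime_lt : ∀ k n, k < n → T.IsHonest k → T.IsHonest n → T.deliveryTime k < T.time n
  honest_infinite : ∀ k, ∃ n, k ≤ n ∧ T.IsHonest n

/-- The index of the first solution found after time `t`. -/
noncomputable def indexAfter (t : ℝ) : ℕ := sInf {n | t < T.time n}

open Classical in
/-- The number of honest blocks among the first `n` solutions. -/
noncomputable def honestCount (n : ℕ) : ℕ := Nat.count T.IsHonest n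

open Classical in
/-- The number of adversarial blocks of the race phase among the first `n` solutions. -/
noncomputable def raceCount (τ : ℝ) (n : ℕ) : ℕ := Nat.count (· ∈ T.raceBlocks τ) n

open Classical in
/-- The largest lead over the honest chain that an adversary can have after `n` solutions: it grows
by one with each adversarial block and shrinks by one, but not below zero, with each honest one. -/
noncomputable def lead : ℕ → ℕ
  | 0 => 0
  | n + 1 => if T.IsHonest n then lead n - 1 else if T.IsAdversarial n then lead n + 1 else lead n

variable {T}

lemma not_isAdversarial {n : ℕ} (h : T.IsHonest n) : ¬ T.IsAdversarial n := fun h' => h'.2 h.2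

lemma isHonest_or_isAdversarial {n : ℕ} (h : T.live n) : T.IsHonest n ∨ T.IsAdversarial n := by
  by_cases hm : T.honestMiner (T.miner n)
  · exact .inl ⟨h, hm⟩
  · exact .inr ⟨h, hm⟩

lemma honestCount_succ_of_isHonest {n : ℕ} (h : T.IsHonest n) :
    T.honestCount (n + 1) = T.honestCount n + 1 := by
  classical simp [honestCount, Nat.count_succ, h]

lemma honestCount_succ_of_not_isHonest {n : ℕ} (h : ¬ T.IsHonest n) :
    T.honestCount (n + 1) = T.honestCount n := by
  classical simp [honestCount, Nat.count_succ, h]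

lemma honestCount_mono : Monotone T.honestCount := by
  classical exact Nat.count_monotone _

lemma honestCount_lt {k n : ℕ} (hk : T.IsHonest k) (hkn : k < n) :
    T.honestCount k < T.honestCount n := by
  have := honestCount_mono (T := T) (Nat.succ_le_of_lt hkn)
  rw [Nat.succ_eq_add_one, honestCount_succ_of_isHonest hk] at this
  omega

lemma raceCount_mono (τ : ℝ) : Monotone (T.raceCount τ) := by
  classical exact Nat.count_monotone _

lemma raceCount_eq_card (τ : ℝ) (n : ℕ) [DecidablePred (· ∈ T.raceBlocks τ)] :
    T.raceCount τ n = ((Finset.range n).filter (· ∈ T.raceBlocks τ)).card := by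
  rw [raceCount, ← Nat.count_eq_card_filter_range]
  congr

lemma lead_succ_of_isHonest {n : ℕ} (h : T.IsHonest n) : T.lead (n + 1) = T.lead n - 1 := by
  simp [lead, h]

lemma lead_succ_of_isAdversarial {n : ℕ} (h : T.IsAdversarial n) :
    T.lead (n + 1) = T.lead n + 1 := by
  have : ¬ T.IsHonest n := fun h' => not_isAdversarial h' h
  simp [lead, h, this]

lemma lead_succ_of_not_live {n : ℕ} (h : ¬ T.live n) : T.lead (n + 1) = T.lead n := by
  have h1 : ¬ T.IsHonest n := fun h' => h h'.1
  have h2 : ¬ T.IsAdversarial n := fun h' => h h'.1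
  simp [lead, h1, h2]

namespace IsSevere

variable (hT : T.IsSevere)
include hT

lemma lt_indexAfter {t : ℝ} {k : ℕ} : k < T.indexAfter t ↔ T.time k ≤ t := by
  have hne : {n | t < T.time n}.Nonempty := hT.time_unbounded t
  constructor
  · intro h
    by_contra hk
    exact absurd (Nat.sInf_le (show k ∈ {n | t < T.time n} from not_le.1 hk)) (not_le.2 h)
  · intro h
    by_contra hk
    have h1 : t < T.time (T.indexAfter t) := Nat.sInf_mem hne
    have h2 := hT.time_strictMono.monotone (not_lt.1 hk)
    linarith

lemma indexAfter_le {t : ℝ} {k : ℕ} : T.indexAfter t ≤ k ↔ t < T.time k := by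
  rw [← not_lt, hT.lt_indexAfter, not_le]

lemma indexAfter_mono : Monotone T.indexAfter := by
  intro s t hst
  by_contra h
  have h1 := hT.lt_indexAfter.1 (not_le.1 h)
  exact lt_irrefl _ (hT.lt_indexAfter.2 (h1.trans hst))

lemma exists_honestCount_eq (r : ℕ) : ∃ n, T.IsHonest n ∧ T.honestCount n = r := by
  classical
  have hinf : {n | T.IsHonest n}.Infinite := by
    rw [Set.infinite_iff_exists_gt]
    intro k
    obtain ⟨n, hn, h⟩ := hT.honest_infinite (k + 1)
    exact ⟨n, h, by omega⟩
  refine ⟨Nat.nth T.IsHonest r, Nat.nth_mem_of_infinite hinf r, ?_⟩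
  have := Nat.count_nth_of_infinite hinf r
  unfold honestCount
  convert this

lemma exists_honestMiner : ∃ j, T.honestMiner j := by
  obtain ⟨n, -, h⟩ := hT.honest_infinite 0
  exact ⟨_, h.2⟩

end IsSevere

end Trace

/-! ### Heights in an arbitrary execution -/

namespace Execution

variable {N : ℕ} {T : Trace N} {τ : ℝ} (X : Execution T τ)

open Classical in
/-- The height of the last honest block among the first `n` solutions. -/
noncomputable def honestHeight : ℕ → ℕ
  | 0 => 1
  | n + 1 => if T.IsHonest n then X.height (some n) else honestHeight n

variable {X}

lemma honestHeight_succ_of_isHonest {n : ℕ} (h : T.IsHonest n) :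
    X.honestHeight (n + 1) = X.height (some n) := by
  simp [honestHeight, h]

lemma honestHeight_succ_of_not_isHonest {n : ℕ} (h : ¬ T.IsHonest n) :
    X.honestHeight (n + 1) = X.honestHeight n := by
  simp [honestHeight, h]

lemma mined_of_onChain {k : ℕ} {c : Block} (h : X.OnChain (some k) c)
    (hc : ∀ n, c = some n → n ∈ X.mined) : k ∈ X.mined := by
  generalize ha : some k = a at h
  induction h with
  | refl => exact hc k ha.symm
  | step n _ ih => exact ih (X.parent_mined n (hc n rfl))

lemma MinedBy.mono {s t : ℝ} {b : Block} (h : X.MinedBy s b) (hst : s ≤ t) : X.MinedBy t b :=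
  fun n hn => ⟨(h n hn).1, (h n hn).2.trans hst⟩

lemma isHonest_or_isAdversarial {n : ℕ} (h : n ∈ X.mined) : T.IsHonest n ∨ T.IsAdversarial n :=
  Trace.isHonest_or_isAdversarial (X.mined_live n h)

lemma public_of_deliveryTime_le {n : ℕ} {t : ℝ} (hn : T.IsHonest n) (h : T.deliveryTime n ≤ t) :
    X.Public t (some n) := fun j hj => (X.view_honest j hj n hn t).2 h

/-- An honest block mined after `τ` does not occur on a chain below the block with `tx`. -/
lemma not_isHonest_of_onChain_parent {n k : ℕ} (hn : n ∈ X.hasTx)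
    (hk : X.OnChain (some k) (X.parent n)) (hτ : τ < T.time k) : ¬ T.IsHonest k := by
  intro h
  by_cases hkt : k ∈ X.hasTx
  · exact X.hasTx_once n hn k hk hkt
  · refine hkt (X.hasTx_honest k h hτ fun a ha => X.hasTx_once n hn a ?_)
    exact (BlockTree.OnChain.step _ _ ha).trans hk

section

variable (hT : T.IsSevere)
include hT

lemma MinedBy.of_onChain {t : ℝ} {a c : Block} (h : X.MinedBy t c) (hac : X.OnChain a c) :
    X.MinedBy t a := by
  rintro k rfl
  refine ⟨mined_of_onChain hac fun n hn => (h n hn).1, ?_⟩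
  obtain ⟨n, rfl, hkn⟩ := hac.exists_index_le
  exact (hT.time_strictMono.monotone hkn).trans (h n rfl).2

/-- Each honest block sees all earlier honest blocks when it is mined, so honest blocks have
strictly increasing heights. -/
lemma height_lt_of_isHonest {k n : ℕ} (hk : T.IsHonest k) (hn : T.IsHonest n) (hkn : k < n) :
    X.height (some k) < X.height (some n) := by
  have h1 : some k ∈ X.view (T.miner n) (T.time n) :=
    (X.view_honest _ hn.2 k hk _).2 (hT.deliveryTime_lt k n hkn hk hn).le
  have h2 := (X.honest_parent n hn).2 _ h1 (by simp; omega)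
  rw [BlockTree.height_some n]
  omega

lemma eq_of_height_eq {k n : ℕ} (hk : T.IsHonest k) (hn : T.IsHonest n)
    (h : X.height (some k) = X.height (some n)) : k = n := by
  rcases lt_trichotomy k n with hlt | heq | hlt
  · exact absurd h (height_lt_of_isHonest hT hk hn hlt).ne
  · exact heq
  · exact absurd h (height_lt_of_isHonest hT hn hk hlt).ne'

lemma honestHeight_lt_height {k n : ℕ} (hn : T.IsHonest n) (hkn : k ≤ n) :
    X.honestHeight k < X.height (some n) := by
  induction k with
  | zero =>
    have := X.one_le_height (X.parent n)
    rw [BlockTree.height_some]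
    change 1 < _
    omega
  | succ k ih =>
    by_cases hk : T.IsHonest k
    · rw [honestHeight_succ_of_isHonest hk]
      exact height_lt_of_isHonest hT hk hn (by omega)
    · rw [honestHeight_succ_of_not_isHonest hk]
      exact ih (by omega)

lemma honestHeight_add_honestCount_le {k n : ℕ} (hkn : k ≤ n) :
    X.honestHeight k + T.honestCount n ≤ X.honestHeight n + T.honestCount k := by
  induction n, hkn using Nat.le_induction with
  | base => exact le_rfl
  | succ n _ ih =>
    by_cases hn : T.IsHonest n
    · have := honestHeight_lt_height (X := X) hT hn le_rfl
      rw [honestHeight_succ_of_isHonest hn, Trace.honestCount_succ_of_isHonest hn]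
      omega
    · rw [honestHeight_succ_of_not_isHonest hn, Trace.honestCount_succ_of_not_isHonest hn]
      exact ih

/-- Honest blocks raise the honest chain by at least one level each. -/
lemma honestHeight_add_honestCount_lt {k n : ℕ} (hn : T.IsHonest n) (hkn : k ≤ n) :
    X.honestHeight k + T.honestCount n < X.height (some n) + T.honestCount k := by
  have h1 := honestHeight_add_honestCount_le (X := X) hT hkn
  have h2 := honestHeight_lt_height (X := X) hT hn le_rfl
  omega

/-- Under any attack, the longest chain exceeds the honest chain by no more than the lead. -/
lemma height_le_honestHeight_add_lead (n : ℕ) (b : Block)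
    (hb : ∀ k, b = some k → k ∈ X.mined ∧ k < n) :
    X.height b ≤ X.honestHeight n + T.lead n := by
  induction n generalizing b with
  | zero =>
    cases b with
    | none => exact le_rfl
    | some k => have := (hb k rfl).2; omega
  | succ n ih =>
    by_cases hbn : b = some n
    · subst hbn
      rcases isHonest_or_isAdversarial (hb n rfl).1 with h | h
      · rw [honestHeight_succ_of_isHonest h]
        omega
      · rw [honestHeight_succ_of_not_isHonest fun h' => Trace.not_isAdversarial h' h,
          Trace.lead_succ_of_isAdversarial h, BlockTree.height_some]
        have := ih (X.parent n) fun k hk =>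
          ⟨X.parent_mined n (hb n rfl).1 k hk, X.parent_lt n k hk⟩
        omega
    · have h0 := ih b fun k hk => ⟨(hb k hk).1, by
        have h1 := (hb k hk).2
        have h2 : k ≠ n := by rintro rfl; exact hbn hk
        omega⟩
      by_cases hl : T.live n
      · rcases Trace.isHonest_or_isAdversarial hl with h | h
        · have := honestHeight_lt_height (X := X) hT h le_rfl
          rw [honestHeight_succ_of_isHonest h, Trace.lead_succ_of_isHonest h]
          omega
        · rw [honestHeight_succ_of_not_isHonest fun h' => Trace.not_isAdversarial h' h,
            Trace.lead_succ_of_isAdversarial h]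
          omega
      · rw [honestHeight_succ_of_not_isHonest fun h' => hl h'.1, Trace.lead_succ_of_not_live hl]
        exact h0

lemma honestHeight_lt_of_time {n : ℕ} (hn : T.IsHonest n) (hτ : τ < T.time n) :
    X.honestHeight (T.indexAfter τ) < X.height (some n) :=
  honestHeight_lt_height hT hn (hT.indexAfter_le.2 hτ)

/-- Blocks higher than the honest chain at time `τ` by more than the lead are mined after `τ`. -/
lemma time_lt_of_lead_lt_height {n : ℕ} (hn : n ∈ X.mined)
    (h : X.honestHeight (T.indexAfter τ) + T.lead (T.indexAfter τ) < X.height (some n)) :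
    τ < T.time n := by
  by_contra hτ
  refine absurd (height_le_honestHeight_add_lead hT (T.indexAfter τ) (some n) ?_) (not_le.2 h)
  rintro k hk
  obtain rfl := Option.some.inj hk
  exact ⟨hn, hT.lt_indexAfter.2 (not_lt.1 hτ)⟩

lemma Public.minedBy {t : ℝ} {b : Block} (h : X.Public t b) : X.MinedBy t b := by
  rintro n rfl
  obtain ⟨j, hj⟩ := hT.exists_honestMiner
  exact X.view_mined j hj t n (h j hj)

/-! ### Two conflicting chains -/

/-- The heights above `n` at which two conflicting chains have two different blocks carry an
adversarial one, because honest blocks have distinct heights. -/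
lemma exists_isAdversarial_of_conflict {n : ℕ} {b c d : Block} (hbn : b ≠ some n)
    (hh : X.height b = X.height (some n)) (hnc : X.OnChain (some n) c) (hbd : X.OnChain b d)
    {s : ℝ} (hc : X.MinedBy s c) (hd : X.MinedBy s d) {x : ℕ} (hx : X.height (some n) ≤ x)
    (hxc : x ≤ X.height c) (hxd : x ≤ X.height d) :
    ∃ k ∈ X.mined, T.IsAdversarial k ∧ T.time k ≤ s ∧ X.height (some k) = x := by
  have h2 : 2 ≤ X.height (some n) := by
    have := X.one_le_height (X.parent n)
    rw [BlockTree.height_some]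
    omega
  obtain ⟨a, hac, hax⟩ := X.exists_onChain_height c (by omega : 1 ≤ x) hxc
  obtain ⟨a', had, hax'⟩ := X.exists_onChain_height d (by omega : 1 ≤ x) hxd
  have hna : X.OnChain (some n) a := hnc.of_height_le hac (by omega)
  have hba : X.OnChain b a' := hbd.of_height_le had (by omega)
  have hne : a ≠ a' := by
    rintro rfl
    have := hba.of_height_le hna hh.le
    exact hbn (this.eq_of_height_le hh.ge)
  have hma := hc.of_onChain hT hac
  have hma' := hd.of_onChain hT had
  cases a with
  | none => rw [BlockTree.height_none] at hax; omega
  | some k =>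
    cases a' with
    | none => rw [BlockTree.height_none] at hax'; omega
    | some k' =>
      rcases isHonest_or_isAdversarial (hma k rfl).1 with h | h
      · rcases isHonest_or_isAdversarial (hma' k' rfl).1 with h' | h'
        · exact absurd (congrArg some (eq_of_height_eq hT h h' (hax.trans hax'.symm))) hne
        · exact ⟨k', (hma' k' rfl).1, h', (hma' k' rfl).2, hax'⟩
      · exact ⟨k, (hma k rfl).1, h, (hma k rfl).2, hax⟩

/-- Every height that two conflicting chains reach, and that exceeds the honest chain at time `τ`
by more than the lead, carries an adversarial block of the race phase. -/
lemma exists_raceBlock_of_lead_lt {n : ℕ} {b c d : Block} (hn : n ∈ X.hasTx) (hbn : b ≠ some n)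
    (hh : X.height b = X.height (some n)) (hnc : X.OnChain (some n) c) (hbd : X.OnChain b d)
    {s : ℝ} (hc : X.MinedBy s c) (hd : X.MinedBy s d) {x : ℕ}
    (hx : X.honestHeight (T.indexAfter τ) + T.lead (T.indexAfter τ) < x)
    (hxc : x ≤ X.height c) (hxd : x ≤ X.height d) :
    ∃ k ∈ T.raceBlocks τ, T.time k ≤ s ∧ X.height (some k) = x := by
  by_cases hxn : X.height (some n) ≤ x
  · obtain ⟨k, hkm, hk, hks, hkx⟩ :=
      exists_isAdversarial_of_conflict hT hbn hh hnc hbd hc hd hxn hxc hxd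
    exact ⟨k, ⟨hk, time_lt_of_lead_lt_height hT hkm (by omega)⟩, hks, hkx⟩
  · have h1 : 1 ≤ X.honestHeight (T.indexAfter τ) + T.lead (T.indexAfter τ) :=
      height_le_honestHeight_add_lead hT _ none (by simp)
    obtain ⟨a, hac, hax⟩ := X.exists_onChain_height c (by omega : 1 ≤ x) hxc
    have hma := hc.of_onChain hT hac
    cases a with
    | none => rw [BlockTree.height_none] at hax; omega
    | some k =>
      have hτ := time_lt_of_lead_lt_height hT (hma k rfl).1 (by omega)
      have hkn : X.OnChain (some k) (some n) := hac.of_height_le hnc (by omega)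
      have hkp := hkn.parent_of_ne (by rintro h; rw [h] at hax; omega)
      rcases isHonest_or_isAdversarial (hma k rfl).1 with h | h
      · exact absurd h (not_isHonest_of_onChain_parent hn hkp hτ)
      · exact ⟨k, ⟨h, hτ⟩, (hma k rfl).2, hax⟩

/-- A set of heights carried by race blocks is not larger than the number of race blocks. -/
lemma card_le_raceCount {s : ℝ} (S : Finset ℕ)
    (hS : ∀ x ∈ S, ∃ k ∈ T.raceBlocks τ, T.time k ≤ s ∧ X.height (some k) = x) :
    S.card ≤ T.raceCount τ (T.indexAfter s) := by
  classical
  rw [Trace.raceCount_eq_card]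
  refine (Finset.card_le_card (t := ((Finset.range (T.indexAfter s)).filter
    (· ∈ T.raceBlocks τ)).image fun k => X.height (some k)) fun x hx => ?_).trans
    Finset.card_image_le
  obtain ⟨k, hk, hks, hkx⟩ := hS x hx
  simp only [Finset.mem_image, Finset.mem_filter, Finset.mem_range]
  exact ⟨k, ⟨hT.lt_indexAfter.2 hks, hk⟩, hkx⟩

/-- The later of two trustworthy chains can be cut below its first honest block that is higher than
the earlier chain; by the longest chain rule it was trustworthy just before that block was mined. -/
lemma exists_trustworthy_truncation {c d b : Block} {t t' : ℝ} (htt : t ≤ t')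
    (hc : X.Trustworthy t c) (hd : X.Trustworthy t' d) (hbd : X.OnChain b d)
    (hbc : X.height b ≤ X.height c) :
    ∃ e s, t ≤ s ∧ X.Trustworthy s e ∧ X.OnChain b e ∧
      min (X.height c) (X.height d) ≤ X.height e ∧
      ∀ k, T.IsHonest k → X.OnChain (some k) e → X.height (some k) ≤ X.height c := by
  classical
  by_cases hex : ∃ k, T.IsHonest k ∧ X.OnChain (some k) d ∧ X.height c < X.height (some k)
  · obtain ⟨hk, hkd, hkc⟩ := Nat.find_spec hex
    have hmin := fun l (hl : l < Nat.find hex) => Nat.find_min hex hl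
    set k := Nat.find hex
    have hpd : X.OnChain (X.parent k) d := (BlockTree.OnChain.step _ _ (.refl _)).trans hkd
    have hpc : X.height c ≤ X.height (X.parent k) := by
      rw [BlockTree.height_some] at hkc; omega
    obtain ⟨s, hts, hps, hs⟩ : ∃ s, t ≤ s ∧ X.MinedBy s (X.parent k) ∧ (s = t ∨ s < T.time k) := by
      have hpm := hd.1.of_onChain hT hpd
      cases hp : X.parent k with
      | none => exact ⟨t, le_rfl, fun n hn => by simp at hn, .inl rfl⟩
      | some l =>
        refine ⟨max t (T.time l), le_max_left _ _, ?_, ?_⟩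
        · rintro n hn
          obtain rfl := Option.some.inj hn
          exact ⟨(hpm l hp).1, le_max_right _ _⟩
        · have := hT.time_strictMono (X.parent_lt _ _ hp)
          rcases le_total t (T.time l) with h | h
          · right; rwa [max_eq_right h]
          · left; exact max_eq_left h
    refine ⟨X.parent k, s, hts, ⟨hps, fun a ha => ?_⟩, hbd.of_height_le hpd (by omega),
      (min_le_left _ _).trans hpc, fun l hl hlp => ?_⟩
    · rcases hs with rfl | hs
      · exact (hc.2 a ha).trans hpc
      · refine (X.honest_parent k hk).2 a (X.view_mono _ hk.2 s _ hs.le (ha _ hk.2)) ?_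
        rintro rfl
        exact absurd (ha.minedBy hT k rfl).2 (not_le.2 hs)
    · by_contra hlc
      exact hmin l hlp.index_lt ⟨hl, hlp.trans hpd, not_le.1 hlc⟩
  · push Not at hex
    exact ⟨d, t', htt, hd, hbd, min_le_right _ _, hex⟩

/-- If two conflicting chains, mined by time `s`, are long enough for confirmation, and the race
blocks fill the levels between them and the public chain, then the lead at time `τ` together with
the race blocks suffices both for the confirmation depth and to keep up with the honest blocks. -/
lemma race_bounds_of_conflict {κ : ℕ} {n : ℕ} {b c d : Block} (hn : n ∈ X.hasTx)
    (hbn : b ≠ some n) (hh : X.height b = X.height (some n)) (hnc : X.OnChain (some n) c)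
    (hbd : X.OnChain b d) {s : ℝ} (hc : X.MinedBy s c) (hd : X.MinedBy s d)
    (hκc : X.height (some n) + κ ≤ X.height c + 1) (hκd : X.height b + κ ≤ X.height d + 1)
    {l : ℕ} (hl : ∀ a, X.Public s a → X.height a ≤ l)
    (hgap : ∀ x, X.honestHeight (T.indexAfter τ) + T.lead (T.indexAfter τ) < x → x ≤ l →
      (x ≤ X.height c ∧ x ≤ X.height d) ∨
        ∃ k ∈ T.raceBlocks τ, T.time k ≤ s ∧ X.height (some k) = x) :
    κ ≤ T.lead (T.indexAfter τ) + T.raceCount τ (T.indexAfter s) ∧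
      ∀ k, T.IsHonest k → τ < T.time k → T.deliveryTime k ≤ s →
        T.honestCount k + 1 ≤ T.honestCount (T.indexAfter τ) + T.lead (T.indexAfter τ) +
          T.raceCount τ (T.indexAfter s) := by
  have hgap' := fun x hx hxl => (hgap x hx hxl).elim
    (fun h => exists_raceBlock_of_lead_lt hT hn hbn hh hnc hbd hc hd hx h.1 h.2) id
  have hlow : ∀ x, X.height (some n) ≤ x → x < X.height (some n) + κ →
      x ∉ Finset.Ioc (X.honestHeight (T.indexAfter τ))
        (X.honestHeight (T.indexAfter τ) + T.lead (T.indexAfter τ)) →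
      ∃ k ∈ T.raceBlocks τ, T.time k ≤ s ∧ X.height (some k) = x := by
    intro x hx1 hx2 hx3
    rw [Finset.mem_Ioc] at hx3
    by_cases hxl : X.honestHeight (T.indexAfter τ) + T.lead (T.indexAfter τ) < x
    · exact exists_raceBlock_of_lead_lt hT hn hbn hh hnc hbd hc hd hxl (by omega) (by omega)
    -- At heights the honest chain had reached by `τ`, the blocks above `n` come too late to be
    -- honest.
    · obtain ⟨a, hac, hax⟩ := X.exists_onChain_height c
        ((X.one_le_height (some n)).trans hx1) (by omega : x ≤ X.height c)
      have hna : X.OnChain (some n) a := hnc.of_height_le hac (by omega)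
      obtain ⟨k, rfl, hnk⟩ := hna.exists_index_le
      have hma := hc.of_onChain hT hac k rfl
      have hτ : τ < T.time k :=
        (X.hasTx_mined n hn).2.trans_le (hT.time_strictMono.monotone hnk)
      rcases isHonest_or_isAdversarial hma.1 with h | h
      · have := honestHeight_lt_of_time (X := X) hT h hτ
        omega
      · exact ⟨k, ⟨h, hτ⟩, hma.2, hax⟩
  constructor
  · have h1 := card_le_raceCount (X := X) (τ := τ) (s := s) hT
      (Finset.Ico (X.height (some n)) (X.height (some n) + κ) \
        Finset.Ioc (X.honestHeight (T.indexAfter τ))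
          (X.honestHeight (T.indexAfter τ) + T.lead (T.indexAfter τ)))
      fun x hx => by
        rw [Finset.mem_sdiff, Finset.mem_Ico] at hx
        exact hlow x hx.1.1 hx.1.2 hx.2
    have h2 := Finset.le_card_sdiff (Finset.Ioc (X.honestHeight (T.indexAfter τ))
          (X.honestHeight (T.indexAfter τ) + T.lead (T.indexAfter τ)))
      (Finset.Ico (X.height (some n)) (X.height (some n) + κ))
    rw [Nat.card_Ico, Nat.card_Ioc] at h2
    omega
  · intro k hk hτ hks
    have h1 := card_le_raceCount (X := X) (τ := τ) (s := s) hT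
      (Finset.Ioc (X.honestHeight (T.indexAfter τ) + T.lead (T.indexAfter τ)) l)
      fun x hx => by
        rw [Finset.mem_Ioc] at hx
        exact hgap' x hx.1 hx.2
    rw [Nat.card_Ioc] at h1
    have h2 := hl _ (public_of_deliveryTime_le (X := X) hk hks)
    have h3 := honestHeight_add_honestCount_lt (X := X) hT hk (hT.indexAfter_le.2 hτ)
    omega

/-- A violation under any attack yields a time at which the lead together with the race blocks
suffices for the confirmation depth and to keep up with the delivered honest blocks. -/
lemma ViolatesConsistency.exists_race_bounds {κ : ℕ} (hκ : 1 ≤ κ) (h : X.ViolatesConsistency κ) :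
    ∃ s, κ ≤ T.lead (T.indexAfter τ) + T.raceCount τ (T.indexAfter s) ∧
      ∀ k, T.IsHonest k → τ < T.time k → T.deliveryTime k ≤ s →
        T.honestCount k + 1 ≤ T.honestCount (T.indexAfter τ) + T.lead (T.indexAfter τ) +
          T.raceCount τ (T.indexAfter s) := by
  obtain ⟨n, hn, b, c, d, t, t', hbn, hh, ⟨htc, hnc, hκc⟩, ⟨htd, hbd, hκd⟩⟩ := h
  have high : ∀ (s : ℝ) (e f : Block), X.MinedBy s e →
      (∀ k, T.IsHonest k → X.OnChain (some k) e → X.height (some k) ≤ X.height f) →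
      ∀ x, X.honestHeight (T.indexAfter τ) + T.lead (T.indexAfter τ) < x → x ≤ X.height e →
        x ≤ X.height f ∨ ∃ k ∈ T.raceBlocks τ, T.time k ≤ s ∧ X.height (some k) = x := by
    intro s e f he hef x hx hxe
    by_cases hxf : x ≤ X.height f
    · exact .inl hxf
    right
    obtain ⟨a, hae, hax⟩ := X.exists_onChain_height e (by omega : 1 ≤ x) hxe
    have hma := he.of_onChain hT hae
    cases a with
    | none => rw [BlockTree.height_none] at hax; have := X.one_le_height f; omega
    | some k =>
      rcases isHonest_or_isAdversarial (hma k rfl).1 with hk | hk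
      · have := hef k hk hae
        omega
      · exact ⟨k, ⟨hk, time_lt_of_lead_lt_height hT (hma k rfl).1 (by omega)⟩, (hma k rfl).2, hax⟩
  rcases le_total t t' with htt | htt
  · obtain ⟨e, s, hts, hse, hbe, hle, hke⟩ :=
      exists_trustworthy_truncation hT htt htc htd hbd (by omega)
    refine ⟨s, race_bounds_of_conflict hT hn hbn hh hnc hbe (htc.1.mono hts) hse.1 hκc (by omega)
      hse.2 fun x hx hxl => ?_⟩
    exact (high s e c hse.1 hke x hx hxl).imp (fun h => ⟨h, hxl⟩) id
  · obtain ⟨e, s, hts, hse, hne, hle, hke⟩ :=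
      exists_trustworthy_truncation hT htt htd htc hnc (by omega)
    refine ⟨s, race_bounds_of_conflict hT hn hbn hh hne hbd hse.1 (htd.1.mono hts) (by omega) hκd
      hse.2 fun x hx hxl => ?_⟩
    exact (high s e d hse.1 hke x hx hxl).imp (fun h => ⟨hxl, h⟩) id

end

end Execution

/-! ### The private chain -/

lemma Nat.exists_isGreatest_of_nonempty {S : Set ℕ} (hne : S.Nonempty) (hb : BddAbove S) :
    ∃ k, IsGreatest S k := ⟨sSup S, Nat.sSup_mem hne hb, fun _ h => le_csSup hb h⟩

lemma exists_isPrivateTip (g : Block) (S : Set ℕ) (n : ℕ) :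
    ∃ p, IsPrivateTip g (S ∩ Set.Iio n) p := by
  rcases (S ∩ Set.Iio n).eq_empty_or_nonempty with h | h
  · exact ⟨g, .inl ⟨h, rfl⟩⟩
  · obtain ⟨k, hk⟩ := Nat.exists_isGreatest_of_nonempty h ⟨n, fun k hk => (Set.mem_Iio.1 hk.2).le⟩
    exact ⟨some k, .inr ⟨k, hk, rfl⟩⟩

namespace Trace

variable {N : ℕ} {T : Trace N} {τ : ℝ}

lemma IsSevere.privateTipAt_iff (hT : T.IsSevere) {g p : Block} {t : ℝ} :
    T.PrivateTipAt τ g t p ↔ IsPrivateTip g (T.raceBlocks τ ∩ Set.Iio (T.indexAfter t)) p := by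
  have : {k ∈ T.raceBlocks τ | T.time k ≤ t} = T.raceBlocks τ ∩ Set.Iio (T.indexAfter t) := by
    ext k
    simp [hT.lt_indexAfter]
  rw [PrivateTipAt, this]

lemma raceCount_eq_zero {n : ℕ} (h : T.raceBlocks τ ∩ Set.Iio n = ∅) : T.raceCount τ n = 0 := by
  classical
  rw [raceCount_eq_card, Finset.card_eq_zero, Finset.filter_eq_empty_iff]
  intro k hk hkr
  have : k ∈ T.raceBlocks τ ∩ Set.Iio n := ⟨hkr, Finset.mem_range.1 hk⟩
  rw [h] at this
  exact this

lemma raceCount_of_isGreatest {n k : ℕ} (h : IsGreatest (T.raceBlocks τ ∩ Set.Iio n) k) :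
    T.raceCount τ n = T.raceCount τ k + 1 := by
  classical
  rw [raceCount_eq_card, raceCount_eq_card, ← Finset.card_insert_of_notMem (a := k) (by simp)]
  congr 1
  ext l
  simp only [Finset.mem_filter, Finset.mem_range, Finset.mem_insert]
  constructor
  · rintro ⟨hln, hl⟩
    have := h.2 ⟨hl, hln⟩
    rcases this.lt_or_eq with h' | h'
    · exact .inr ⟨h', hl⟩
    · exact .inl h'
  · rintro (rfl | ⟨hlk, hl⟩)
    · exact ⟨h.1.2, h.1.1⟩
    · exact ⟨hlk.trans h.1.2, hl⟩

end Trace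

namespace Execution

variable {N : ℕ} {T : Trace N} {τ : ℝ} {Y : Execution T τ} {κ : ℕ} {g : Block}

namespace FollowsPrivateMining

variable (hY : Y.FollowsPrivateMining κ g)
include hY

lemma height_of_isPrivateTip (n : ℕ) {p : Block}
    (hp : IsPrivateTip g (T.raceBlocks τ ∩ Set.Iio n) p) :
    Y.height p = Y.height g + T.raceCount τ n := by
  induction n using Nat.strong_induction_on generalizing p with
  | _ n ih =>
    rcases hp with ⟨h, rfl⟩ | ⟨k, hk, rfl⟩
    · rw [Trace.raceCount_eq_zero h]
      rfl
    · rw [Trace.raceCount_of_isGreatest hk, BlockTree.height_some,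
        ih k hk.1.2 (hY.race k hk.1.1)]
      omega

lemma mem_raceBlocks_or_onChain {S : Set ℕ} (hS : S ⊆ T.raceBlocks τ) {a p : Block}
    (hp : IsPrivateTip g S p) (ha : Y.OnChain a p) :
    (∃ k ∈ T.raceBlocks τ, a = some k) ∨ Y.OnChain a g := by
  have key : ∀ n ∈ T.raceBlocks τ, ∀ a, Y.OnChain a (some n) →
      (∃ k ∈ T.raceBlocks τ, a = some k) ∨ Y.OnChain a g := by
    intro n
    induction n using Nat.strong_induction_on with
    | _ n ih =>
      intro hn a ha
      by_cases han : a = some n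
      · exact .inl ⟨n, hn, han⟩
      have ha' := ha.parent_of_ne han
      rcases hY.race n hn with ⟨-, h⟩ | ⟨k, hk, h⟩
      · exact .inr (h ▸ ha')
      · exact ih k hk.1.2 hk.1.1 a (h ▸ ha')
  rcases hp with ⟨-, rfl⟩ | ⟨k, hk, rfl⟩
  · exact .inr ha
  · exact key k (hS hk.1) a ha

variable (hT : T.IsSevere)
include hT

/-- Private mining attains the largest possible lead in the cheating phase. -/
lemma honestCount_add_lead_le_height :
    T.honestCount (T.indexAfter τ) + T.lead (T.indexAfter τ) + 1 ≤ Y.height g := by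
  have key : ∀ n ≤ T.indexAfter τ, ∃ z, (∀ k, z = some k → k ∈ Y.mined ∧ k < n) ∧
      T.honestCount n + T.lead n + 1 ≤ Y.height z := by
    intro n
    induction n with
    | zero => exact fun _ => ⟨none, by simp, by simp [Trace.honestCount, Trace.lead,
        BlockTree.height_none]⟩
    | succ n ih =>
      intro hn
      obtain ⟨z, hz, hzh⟩ := ih (by omega)
      have hz' : ∀ k, z = some k → k ∈ Y.mined ∧ k < n + 1 :=
        fun k hk => ⟨(hz k hk).1, (hz k hk).2.trans (by omega)⟩
      by_cases hl : T.live n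
      · rcases Trace.isHonest_or_isAdversarial hl with h | h
        · rw [Trace.honestCount_succ_of_isHonest h, Trace.lead_succ_of_isHonest h]
          by_cases h0 : T.lead n = 0
          · refine ⟨some n, fun k hk => ?_, ?_⟩
            · obtain rfl := Option.some.inj hk
              exact ⟨Y.honest_mined _ h, by omega⟩
            · have := honestHeight_add_honestCount_lt (X := Y) hT h (Nat.zero_le n)
              have h1 : Y.honestHeight 0 = 1 := rfl
              have h2 : T.honestCount 0 = 0 := by simp [Trace.honestCount]
              omega
          · exact ⟨z, hz', by omega⟩
        · rw [Trace.honestCount_succ_of_not_isHonest fun h' => Trace.not_isAdversarial h' h,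
            Trace.lead_succ_of_isAdversarial h]
          refine ⟨some n, fun k hk => ?_, ?_⟩
          · obtain rfl := Option.some.inj hk
            exact ⟨hY.uses_all _ h, by omega⟩
          · have hzp : Y.height z ≤ Y.height (Y.parent n) := by
              cases z with
              | none => exact Y.one_le_height _
              | some k => exact hY.cheating n h (hT.lt_indexAfter.1 hn) k (hz k rfl).1 (hz k rfl).2
            rw [BlockTree.height_some]
            omega
      · rw [Trace.honestCount_succ_of_not_isHonest fun h' => hl h'.1,
          Trace.lead_succ_of_not_live hl]
        exact ⟨z, hz', hzh⟩
  obtain ⟨z, hz, hzh⟩ := key _ le_rfl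
  exact hzh.trans (hY.race_start.2 z fun k hk =>
    ⟨(hz k hk).1, hT.lt_indexAfter.1 (hz k hk).2⟩)

/-- The publishing event is a violation: the private chain conflicts with the chain that confirms
`tx` and is at least as long. -/
lemma violatesConsistency_of_publishEvent {s : ℝ} (h : Y.PublishEvent κ g s) :
    Y.ViolatesConsistency κ := by
  obtain ⟨n, hn, c, p, hc, hp, hcp⟩ := h
  obtain ⟨hnm, hτn⟩ := Y.hasTx_mined n hn
  have hnc := hc.2.1.height_le
  have hτs : τ < s := by
    obtain ⟨k, rfl, hnk⟩ := hc.2.1.exists_index_le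
    exact hτn.trans_le ((hT.time_strictMono.monotone hnk).trans (hc.1.1 k rfl).2)
  obtain ⟨b, hbp, hbh⟩ := Y.exists_onChain_height p (Y.one_le_height (some n)) (by omega)
  have hpm : Y.MinedBy s p := by
    rcases hp with ⟨-, rfl⟩ | ⟨k, hk, rfl⟩
    · exact hY.race_start.1.mono hτs.le
    · rintro l hl
      obtain rfl := Option.some.inj hl
      exact ⟨hY.uses_all _ hk.1.1.1, hk.1.2⟩
  refine ⟨n, hn, b, c, p, s, s, ?_, hbh, hc, ⟨hpm, fun a ha => (hc.1.2 a ha).trans hcp⟩, hbp, ?_⟩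
  · rintro rfl
    rcases hY.mem_raceBlocks_or_onChain (fun k hk => hk.1) hp hbp with ⟨k, hk, hkn⟩ | hg
    · obtain rfl := Option.some.inj hkn
      exact hY.excludes _ hk.1 hn
    · exact absurd (hY.race_start.1.of_onChain hT hg n rfl).2 (not_le.2 hτn)
  · have := hc.2.2
    omega

omit hT in
lemma isHonest_of_mem_view (hno : ∀ s, ¬ Y.PublishEvent κ g s) {j : Fin N} (hj : T.honestMiner j)
    {t : ℝ} {k : ℕ} (hk : some k ∈ Y.view j t) : T.IsHonest k := by
  rcases isHonest_or_isAdversarial (Y.view_mined j hj t k hk).1 with h | h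
  · exact h
  · obtain ⟨s, -, hs⟩ := hY.withholds j hj t k h hk
    exact absurd hs (hno s)

/-- As long as nothing is published, the honest blocks form one chain. -/
lemma height_of_isHonest (hno : ∀ s, ¬ Y.PublishEvent κ g s) {n : ℕ} (hn : T.IsHonest n) :
    Y.height (some n) = T.honestCount n + 2 := by
  induction n using Nat.strong_induction_on with
  | _ n ih =>
    have h1 := honestHeight_add_honestCount_lt (X := Y) hT hn (Nat.zero_le n)
    have h2 : Y.honestHeight 0 = 1 := rfl
    have h3 : T.honestCount 0 = 0 := by simp [Trace.honestCount]
    have h4 := BlockTree.height_some (B := Y.toBlockTree) n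
    cases hp : Y.parent n with
    | none => rw [hp, BlockTree.height_none] at h4; omega
    | some k =>
      have hk := hY.isHonest_of_mem_view hno hn.2 (hp ▸ (Y.honest_parent n hn).1)
      have hkn := Y.parent_lt n k hp
      have := Trace.honestCount_lt hk hkn
      have := ih k hkn hk
      rw [hp] at h4
      omega

omit hT in
lemma isHonest_of_onChain (hno : ∀ s, ¬ Y.PublishEvent κ g s) {k n : ℕ} (hn : T.IsHonest n)
    (h : Y.OnChain (some k) (some n)) : T.IsHonest k := by
  induction n using Nat.strong_induction_on with
  | _ n ih =>
    by_cases hkn : k = n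
    · exact hkn ▸ hn
    have h' := h.parent_of_ne (by simpa using hkn)
    obtain ⟨l, hl, -⟩ := h'.exists_index_le
    exact ih l (Y.parent_lt n l hl)
      (hY.isHonest_of_mem_view hno hn.2 (hl ▸ (Y.honest_parent n hn).1)) (hl ▸ h')

lemma onChain_of_isHonest (hno : ∀ s, ¬ Y.PublishEvent κ g s) {k n : ℕ} (hk : T.IsHonest k)
    (hn : T.IsHonest n) (hkn : k ≤ n) : Y.OnChain (some k) (some n) := by
  obtain ⟨a, ha, hak⟩ := Y.exists_onChain_height (some n) (Y.one_le_height (some k))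
    (by
      rw [hY.height_of_isHonest hT hno hk, hY.height_of_isHonest hT hno hn]
      have := Trace.honestCount_mono (T := T) hkn
      omega)
  cases a with
  | none =>
    rw [hY.height_of_isHonest hT hno hk, BlockTree.height_none] at hak
    omega
  | some l =>
    have hl := hY.isHonest_of_onChain hno hn ha
    rwa [eq_of_height_eq hT hl hk hak] at ha

/-- If the lead and the race blocks suffice, in the sense of
`ViolatesConsistency.exists_race_bounds`, then the private chain is published. -/
lemma exists_publishEvent (hκ : 1 ≤ κ) {s : ℝ}
    (h1 : κ ≤ T.lead (T.indexAfter τ) + T.raceCount τ (T.indexAfter s))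
    (h2 : ∀ k, T.IsHonest k → τ < T.time k → T.deliveryTime k ≤ s →
      T.honestCount k + 1 ≤ T.honestCount (T.indexAfter τ) + T.lead (T.indexAfter τ) +
        T.raceCount τ (T.indexAfter s)) :
    ∃ s, Y.PublishEvent κ g s := by
  by_contra! hno
  -- `m` is the first honest block after `τ`, and `k` the one that gives it depth `κ`.
  obtain ⟨m, hm, hmc⟩ := hT.exists_honestCount_eq (T.honestCount (T.indexAfter τ))
  obtain ⟨k, hk, hkc⟩ := hT.exists_honestCount_eq (T.honestCount (T.indexAfter τ) + κ - 1)
  have hmτ : T.indexAfter τ ≤ m := by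
    by_contra hlt
    have := Trace.honestCount_lt hm (not_le.1 hlt)
    omega
  have hmk : m ≤ k := by
    by_contra hlt
    have := Trace.honestCount_lt hk (not_le.1 hlt)
    omega
  have hτ : ∀ l, m ≤ l → τ < T.time l := fun l hl => hT.indexAfter_le.1 (hmτ.trans hl)
  have hmtx : m ∈ Y.hasTx := by
    refine Y.hasTx_honest m hm (hτ m le_rfl) fun a ha hat => ?_
    have hah := hY.isHonest_of_onChain hno hm (.step _ _ ha)
    have hc := Trace.honestCount_lt hah ha.index_lt
    have h := Trace.honestCount_mono (T := T) (hT.indexAfter_le.2 (Y.hasTx_mined a hat).2)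
    omega
  -- Waiting for `k` does not spoil the bounds.
  set s' := max s (T.time k)
  have hrc : T.raceCount τ (T.indexAfter s) ≤ T.raceCount τ (T.indexAfter s') :=
    Trace.raceCount_mono τ (hT.indexAfter_mono (le_max_left _ _))
  obtain ⟨c, ⟨hc, hcs, hck⟩, hcmax⟩ := Nat.exists_isGreatest_of_nonempty
    (S := {l | T.IsHonest l ∧ T.time l ≤ s' ∧ (l = k ∨ T.deliveryTime l ≤ s')})
    ⟨k, hk, le_max_right _ _, .inl rfl⟩
    ⟨T.indexAfter s', fun l hl => (hT.lt_indexAfter.2 hl.2.1).le⟩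
  have hkc' : k ≤ c := hcmax ⟨hk, le_max_right _ _, .inl rfl⟩
  have hcount : T.honestCount c + 1 ≤ T.honestCount (T.indexAfter τ) + T.lead (T.indexAfter τ) +
      T.raceCount τ (T.indexAfter s') := by
    by_cases hlt : c ≤ k
    · have := Trace.honestCount_mono (T := T) hlt
      omega
    · have hd : T.deliveryTime c ≤ s := by
        have hd' := hck.resolve_left (by omega)
        have := (hT.time_strictMono (not_le.1 hlt)).trans_le (hT.time_le_deliveryTime c)
        rcases le_max_iff.1 hd' with h | h
        · exact h
        · linarith
      have := h2 c hc (hτ c (hmk.trans hkc')) hd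
      omega
  obtain ⟨p, hp⟩ := exists_isPrivateTip g (T.raceBlocks τ) (T.indexAfter s')
  refine hno s' ⟨m, hmtx, some c, p, ⟨⟨?_, fun b hb => ?_⟩,
    hY.onChain_of_isHonest hT hno hm hc (hmk.trans hkc'), ?_⟩, hT.privateTipAt_iff.2 hp, ?_⟩
  · rintro l hl
    obtain rfl := Option.some.inj hl
    exact ⟨Y.honest_mined _ hc, hcs⟩
  · cases b with
    | none => exact Y.one_le_height _
    | some l =>
      obtain ⟨j, hj⟩ := hT.exists_honestMiner
      have hl := hY.isHonest_of_mem_view hno hj (hb j hj)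
      have hld := (Y.view_honest j hj l hl _).1 (hb j hj)
      have := Trace.honestCount_mono (T := T)
        (hcmax ⟨hl, (hT.time_le_deliveryTime l).trans hld, .inr hld⟩)
      rw [hY.height_of_isHonest hT hno hl, hY.height_of_isHonest hT hno hc]
      omega
  · have := Trace.honestCount_mono (T := T) hkc'
    rw [hY.height_of_isHonest hT hno hm, hY.height_of_isHonest hT hno hc]
    omega
  · have := hY.honestCount_add_lead_le_height hT
    rw [hY.height_of_isHonest hT hno hc, hY.height_of_isPrivateTip _ hp]
    omega

end FollowsPrivateMining

end Execution

/-! ### Construction of private-mining executions -/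

/-- The height of a block when the heights of the mined blocks are given by `ht`. -/
def blockHeight (ht : ℕ → ℕ) (b : Block) : ℕ := b.elim 1 ht

open Classical in
/-- The latest among the blocks of maximal height, according to `ht`, in the set consisting of
genesis and the blocks in `S` with index below `n`. -/
noncomputable def tallest (ht : ℕ → ℕ) (S : Set ℕ) : ℕ → Block
  | 0 => none
  | n + 1 => if n ∈ S ∧ blockHeight ht (tallest ht S n) ≤ ht n then some n else tallest ht S n

section tallest

variable {ht ht' : ℕ → ℕ} {S : Set ℕ}

lemma mem_of_tallest_eq {n k : ℕ} (h : tallest ht S n = some k) : k ∈ S ∧ k < n := by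
  induction n with
  | zero => simp [tallest] at h
  | succ n ih =>
    rw [tallest] at h
    split_ifs at h with hn
    · obtain rfl := Option.some.inj h
      exact ⟨hn.1, by omega⟩
    · exact ⟨(ih h).1, (ih h).2.trans (by omega)⟩

lemma blockHeight_le_tallest {n : ℕ} {b : Block} (hb : ∀ k, b = some k → k ∈ S ∧ k < n) :
    blockHeight ht b ≤ blockHeight ht (tallest ht S n) := by
  induction n generalizing b with
  | zero =>
    cases b with
    | none => exact le_rfl
    | some k => exact absurd (hb k rfl).2 (by omega)
  | succ n ih =>
    rw [tallest]
    by_cases hbn : b = some n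
    · subst hbn
      split_ifs with hn
      · exact le_rfl
      · exact (not_le.1 fun h => hn ⟨(hb n rfl).1, h⟩).le
    · have h0 := ih fun k hk => ⟨(hb k hk).1, lt_of_le_of_ne (Nat.lt_succ_iff.1 (hb k hk).2)
        (by rintro rfl; exact hbn hk)⟩
      split_ifs with hn
      · exact h0.trans hn.2
      · exact h0

lemma blockHeight_congr {n : ℕ} (h : ∀ k < n, ht k = ht' k) {b : Block}
    (hb : ∀ k, b = some k → k < n) : blockHeight ht b = blockHeight ht' b := by
  cases b with
  | none => rfl
  | some k => exact h k (hb k rfl)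

lemma tallest_congr {n : ℕ} (h : ∀ k < n, ht k = ht' k) :
    tallest ht S n = tallest ht' S n := by
  induction n with
  | zero => rfl
  | succ n ih =>
    have h' := ih fun k hk => h k (by omega)
    rw [tallest, tallest, ← h', ← h n (by omega),
      blockHeight_congr (fun k hk => h k (by omega)) fun k hk => (mem_of_tallest_eq hk).2]

end tallest

namespace BlockTree

variable {B B' : BlockTree} {m : ℕ}

lemma height_congr (h : ∀ k < m, B.parent k = B'.parent k) (b : Block)
    (hb : ∀ k, b = some k → k < m) : B.height b = B'.height b := by
  cases b with
  | none => rfl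
  | some n =>
    have hn := hb n rfl
    clear hb
    induction n using Nat.strong_induction_on with
    | _ n ih =>
      rw [height_some, height_some, ← h n hn]
      cases hp : B.parent n with
      | none => rfl
      | some k =>
        have := B.parent_lt n k hp
        rw [ih k this (this.trans hn)]

lemma OnChain.congr (h : ∀ k < m, B.parent k = B'.parent k) {a c : Block}
    (hc : ∀ k, c = some k → k < m) (hac : B.OnChain a c) : B'.OnChain a c := by
  induction hac with
  | refl => exact .refl _
  | step n _ ih =>
    have hn := hc n rfl
    refine .step _ _ (h n hn ▸ ih fun k hk => (B.parent_lt n k hk).trans hn)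

end BlockTree

namespace Trace

variable {N : ℕ} (T : Trace N) (τ : ℝ) (Q : Set ℝ)

open Classical in
/-- The parent of the `n`-th block under private mining when the earlier blocks have heights `ht`
and the adversarial blocks are public at the times in `Q`. -/
noncomputable def privateParent (ht : ℕ → ℕ) (n : ℕ) : Block :=
  if T.IsHonest n then tallest ht {k | T.IsHonest k ∨ (T.live k ∧ T.time n ∈ Q)} n
  else if T.time n ≤ τ then tallest ht {k | T.live k} n
  else if (T.raceBlocks τ ∩ Set.Iio n).Nonempty then some (sSup (T.raceBlocks τ ∩ Set.Iio n))
  else tallest ht {k | T.live k} (min n (T.indexAfter τ))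

variable {T τ Q}

lemma isGreatest_raceBlocks {n : ℕ} (h : (T.raceBlocks τ ∩ Set.Iio n).Nonempty) :
    IsGreatest (T.raceBlocks τ ∩ Set.Iio n) (sSup (T.raceBlocks τ ∩ Set.Iio n)) := by
  have hb : BddAbove (T.raceBlocks τ ∩ Set.Iio n) := ⟨n, fun k hk => (Set.mem_Iio.1 hk.2).le⟩
  exact ⟨Nat.sSup_mem h hb, fun _ hk => le_csSup hb hk⟩

lemma privateParent_spec {ht : ℕ → ℕ} {n k : ℕ} (h : T.privateParent τ Q ht n = some k) :
    T.live k ∧ k < n := by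
  rw [privateParent] at h
  split_ifs at h with h1 h2 h3
  · obtain ⟨h4, h5⟩ := mem_of_tallest_eq h
    exact ⟨h4.elim (fun h => h.1) (fun h => h.1), h5⟩
  · exact mem_of_tallest_eq h
  · obtain rfl := Option.some.inj h
    have := (isGreatest_raceBlocks h3).1
    exact ⟨this.1.1.1, this.2⟩
  · obtain ⟨h4, h5⟩ := mem_of_tallest_eq h
    exact ⟨h4, h5.trans_le (min_le_left _ _)⟩

lemma privateParent_congr {Q' : Set ℝ} {ht ht' : ℕ → ℕ} {n : ℕ} (h : ∀ k < n, ht k = ht' k)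
    (hQ : T.time n ∈ Q ↔ T.time n ∈ Q') :
    T.privateParent τ Q ht n = T.privateParent τ Q' ht' n := by
  rw [privateParent, privateParent, hQ, tallest_congr h, tallest_congr h,
    tallest_congr fun k hk => h k (hk.trans_le (min_le_left _ _))]

variable (T τ Q)

/-- The heights of the blocks under private mining, when the adversarial blocks are public at the
times in `Q`. -/
noncomputable def privateHeight (n : ℕ) : ℕ :=
  blockHeight (fun k => if _h : k < n then privateHeight k else 0)
    (T.privateParent τ Q (fun k => if _h : k < n then privateHeight k else 0) n) + 1
termination_by n

lemma privateHeight_eq (n : ℕ) : T.privateHeight τ Q n =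
    blockHeight (T.privateHeight τ Q) (T.privateParent τ Q (T.privateHeight τ Q) n) + 1 := by
  have h : ∀ k < n, (fun k => if _h : k < n then T.privateHeight τ Q k else 0) k =
      T.privateHeight τ Q k := fun k hk => by simp [hk]
  conv_lhs => rw [privateHeight]
  rw [privateParent_congr h Iff.rfl, blockHeight_congr h fun k hk => (privateParent_spec hk).2]

/-- The block tree of private mining when the adversarial blocks are public at the times in `Q`. -/
noncomputable def privateTree : BlockTree where
  parent := T.privateParent τ Q (T.privateHeight τ Q)
  parent_lt _ _ h := (privateParent_spec h).2

variable {T τ Q}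

lemma height_privateTree (b : Block) :
    (T.privateTree τ Q).height b = blockHeight (T.privateHeight τ Q) b := by
  cases b with
  | none => rfl
  | some n =>
    induction n using Nat.strong_induction_on with
    | _ n ih =>
      change _ = T.privateHeight τ Q n
      rw [BlockTree.height_some, privateHeight_eq]
      change (T.privateTree τ Q).height (T.privateParent τ Q (T.privateHeight τ Q) n) + 1 = _
      cases hp : T.privateParent τ Q (T.privateHeight τ Q) n with
      | none => rfl
      | some k => rw [ih k (privateParent_spec hp).2]

lemma privateHeight_congr {Q' : Set ℝ} (n : ℕ)
    (hQ : ∀ k ≤ n, T.time k ∈ Q ↔ T.time k ∈ Q') :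
    T.privateHeight τ Q n = T.privateHeight τ Q' n := by
  induction n using Nat.strong_induction_on with
  | _ n ih =>
    have h : ∀ k < n, T.privateHeight τ Q k = T.privateHeight τ Q' k :=
      fun k hk => ih k hk fun l hl => hQ l (hl.trans hk.le)
    rw [privateHeight_eq, privateHeight_eq, privateParent_congr h (hQ n le_rfl),
      blockHeight_congr h fun k hk => (privateParent_spec hk).2]

/-- The first honest blocks after `τ` on their chains. -/
def firstHonestAfter (T : Trace N) (τ : ℝ) (B : BlockTree) : Set ℕ :=
  {n | T.IsHonest n ∧ τ < T.time n ∧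
    ∀ a, B.OnChain (some a) (B.parent n) → ¬ (T.IsHonest a ∧ τ < T.time a)}

lemma exists_mem_firstHonestAfter {B : BlockTree} {a : ℕ} (ha : T.IsHonest a)
    (hτ : τ < T.time a) : ∃ k ∈ T.firstHonestAfter τ B, B.OnChain (some k) (some a) := by
  induction a using Nat.strong_induction_on with
  | _ a ih =>
    by_cases h : ∃ l, B.OnChain (some l) (B.parent a) ∧ T.IsHonest l ∧ τ < T.time l
    · obtain ⟨l, hl, hlh, hlτ⟩ := h
      obtain ⟨k, hk, hkl⟩ := ih l hl.index_lt hlh hlτ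
      exact ⟨k, hk, hkl.trans (.step _ _ hl)⟩
    · push Not at h
      exact ⟨a, ⟨ha, hτ, fun l hl hl' => not_lt.2 (h l hl hl'.1) hl'.2⟩, .refl _⟩

/-- The execution of private mining when the adversarial blocks are public at the times in `Q`. -/
noncomputable def privateExecution (hT : T.IsSevere) (hQ : IsUpperSet Q)
    (hdel : ∀ t ∈ Q, ∀ k, T.IsHonest k → T.time k ≤ τ → T.deliveryTime k ≤ t) :
    Execution T τ where
  toBlockTree := T.privateTree τ Q
  mined := {n | T.live n}
  mined_live _ h := h
  honest_mined _ h := h.1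
  parent_mined _ _ _ hk := (privateParent_spec hk).1
  hasTx := T.firstHonestAfter τ (T.privateTree τ Q)
  hasTx_mined _ h := ⟨h.1.1, h.2.1⟩
  hasTx_once n hn a ha hat := hn.2.2 a ha ⟨hat.1, hat.2.1⟩
  hasTx_honest n hn hτ h := ⟨hn, hτ, fun a ha hah => by
    obtain ⟨k, hk, hka⟩ := exists_mem_firstHonestAfter (B := T.privateTree τ Q) hah.1 hah.2
    exact h k (hka.trans ha) hk⟩
  view _ t := {b | ∀ n, b = some n → (T.IsHonest n ∧ T.deliveryTime n ≤ t) ∨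
    (T.IsAdversarial n ∧ T.time n ≤ t ∧ t ∈ Q)}
  genesis_view _ _ _ n hn := by simp at hn
  view_mined _ _ t n h := by
    rcases h n rfl with h | h
    · exact ⟨h.1.1, (hT.time_le_deliveryTime n).trans h.2⟩
    · exact ⟨h.1.1, h.2.1⟩
  view_mono _ _ s t hst b hb n hn := (hb n hn).imp (fun h => ⟨h.1, h.2.trans hst⟩)
    fun h => ⟨h.1, h.2.1.trans hst, hQ hst h.2.2⟩
  view_parent j hj t n hn k hk := by
    have hlt := hT.time_strictMono (privateParent_spec hk).2
    rcases hn n rfl with ⟨h, hd⟩ | ⟨h, hd, htQ⟩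
    · have hnt := (hT.time_le_deliveryTime n).trans hd
      change T.privateParent τ Q _ n = _ at hk
      rw [privateParent, if_pos h] at hk
      obtain ⟨hkh | ⟨hkl, hnQ⟩, hkn⟩ := mem_of_tallest_eq hk
      · exact .inl ⟨hkh, (hT.deliveryTime_lt k n hkn hkh h).le.trans hnt⟩
      · rcases isHonest_or_isAdversarial hkl with hkh | hka
        · exact .inl ⟨hkh, (hT.deliveryTime_lt k n hkn hkh h).le.trans hnt⟩
        · exact .inr ⟨hka, hlt.le.trans hnt, hQ hnt hnQ⟩
    · rcases isHonest_or_isAdversarial (privateParent_spec hk).1 with hkh | hka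
      · refine .inl ⟨hkh, hdel t htQ k hkh ?_⟩
        change T.privateParent τ Q _ n = _ at hk
        rw [privateParent, if_neg fun h' => not_isAdversarial h' h] at hk
        split_ifs at hk with h2 h3
        · exact hlt.le.trans h2
        · obtain rfl := Option.some.inj hk
          exact absurd (isGreatest_raceBlocks h3).1.1.1 (not_isAdversarial hkh)
        · exact hT.lt_indexAfter.1 ((mem_of_tallest_eq hk).2.trans_le (min_le_right _ _))
      · exact .inr ⟨hka, hlt.le.trans hd, htQ⟩
  view_honest j hj n hn t := by
    constructor
    · intro h
      rcases h n rfl with h | h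
      · exact h.2
      · exact absurd h.1 (not_isAdversarial hn)
    · rintro h k hk
      obtain rfl := Option.some.inj hk
      exact .inl ⟨hn, h⟩
  honest_parent n hn := by
    have hp : (T.privateTree τ Q).parent n = tallest (T.privateHeight τ Q)
        {k | T.IsHonest k ∨ (T.live k ∧ T.time n ∈ Q)} n := by
      change T.privateParent τ Q _ n = _
      rw [privateParent, if_pos hn]
    constructor
    · intro k hk
      rw [hp] at hk
      obtain ⟨h, hkn⟩ := mem_of_tallest_eq hk
      by_cases hkh : T.IsHonest k
      · exact .inl ⟨hkh, (hT.deliveryTime_lt k n hkn hkh hn).le⟩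
      · obtain ⟨hkl, hnQ⟩ := h.resolve_left hkh
        exact .inr ⟨(isHonest_or_isAdversarial hkl).resolve_left hkh,
          (hT.time_strictMono hkn).le, hnQ⟩
    · intro b hb hbn
      rw [height_privateTree, height_privateTree, hp]
      refine blockHeight_le_tallest fun k hk => ?_
      have hkn : k ≠ n := by rintro rfl; exact hbn hk
      rcases hb k hk with h | h
      · exact ⟨.inl h.1, lt_of_le_of_ne (hT.time_strictMono.le_iff_le.1
          ((hT.time_le_deliveryTime k).trans h.2)) hkn⟩
      · exact ⟨.inr ⟨h.1.1, h.2.2⟩, lt_of_le_of_ne (hT.time_strictMono.le_iff_le.1 h.2.1) hkn⟩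

/-- The block at which the race of the constructed execution starts. -/
noncomputable def raceStart (T : Trace N) (τ : ℝ) (Q : Set ℝ) : Block :=
  tallest (T.privateHeight τ Q) {k | T.live k} (T.indexAfter τ)

lemma followsPrivateMining_privateExecution (hT : T.IsSevere) (hQ : IsUpperSet Q)
    (hdel : ∀ t ∈ Q, ∀ k, T.IsHonest k → T.time k ≤ τ → T.deliveryTime k ≤ t) {κ : ℕ}
    (hafter : ∀ t ∈ Q, τ < t)
    (hwith : ∀ t ∈ Q, ∃ s < t,
      (privateExecution hT hQ hdel).PublishEvent κ (T.raceStart τ Q) s)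
    (hpub : ∀ s t, (privateExecution hT hQ hdel).PublishEvent κ (T.raceStart τ Q) s → s < t →
      t ∈ Q) :
    (privateExecution hT hQ hdel).FollowsPrivateMining κ (T.raceStart τ Q) where
  uses_all _ h := h.1
  cheating n hn hτ k hk hkn := by
    change (T.privateTree τ Q).height _ ≤ (T.privateTree τ Q).height
      (T.privateParent τ Q (T.privateHeight τ Q) n)
    rw [height_privateTree, height_privateTree, privateParent,
      if_neg fun h => not_isAdversarial h hn, if_pos hτ]
    refine blockHeight_le_tallest fun l hl => ?_
    obtain rfl := Option.some.inj hl
    exact ⟨hk, hkn⟩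
  race_start := by
    refine ⟨fun k hk => ?_, fun b hb => ?_⟩
    · obtain ⟨h1, h2⟩ := mem_of_tallest_eq hk
      exact ⟨h1, hT.lt_indexAfter.1 h2⟩
    · change (T.privateTree τ Q).height _ ≤ (T.privateTree τ Q).height _
      rw [height_privateTree, height_privateTree]
      exact blockHeight_le_tallest fun k hk => ⟨(hb k hk).1, hT.lt_indexAfter.2 (hb k hk).2⟩
  race n hn := by
    change IsPrivateTip _ _ (T.privateParent τ Q (T.privateHeight τ Q) n)
    rw [privateParent, if_neg fun h => not_isAdversarial h hn.1, if_neg (not_le.2 hn.2)]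
    split_ifs with h
    · exact .inr ⟨_, isGreatest_raceBlocks h, rfl⟩
    · rw [min_eq_right (hT.indexAfter_le.2 hn.2)]
      exact .inl ⟨Set.not_nonempty_iff_eq_empty.1 h, rfl⟩
  excludes n hn h := not_isAdversarial h.1 hn
  withholds j hj t n hn h := by
    rcases h n rfl with h | h
    · exact absurd hn (not_isAdversarial h.1)
    · exact hwith t h.2.2
  publishes s p hs hp t hst j hj k hk := by
    have htQ := hpub s t hs hst
    rcases hp with ⟨-, rfl⟩ | ⟨l, hl, rfl⟩
    · obtain ⟨h1, h2⟩ := mem_of_tallest_eq hk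
      have h2 := hT.lt_indexAfter.1 h2
      rcases isHonest_or_isAdversarial h1 with h | h
      · exact .inl ⟨h, hdel t htQ k h h2⟩
      · exact .inr ⟨h, h2.trans (hafter t htQ).le, htQ⟩
    · obtain rfl := Option.some.inj hk
      exact .inr ⟨hl.1.1.1, hl.1.2.trans hst.le, htQ⟩

end Trace

namespace Execution

variable {N : ℕ} {T : Trace N} {τ : ℝ} {X X' : Execution T τ} {κ : ℕ} {g : Block} {s : ℝ}

lemma PublishEvent.exists_hasTx_time_le (hT : T.IsSevere) (h : X.PublishEvent κ g s) :
    ∃ n ∈ X.hasTx, T.time n ≤ s := by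
  obtain ⟨n, hn, c, p, hc, -⟩ := h
  obtain ⟨k, rfl, hnk⟩ := hc.2.1.exists_index_le
  exact ⟨n, hn, (hT.time_strictMono.monotone hnk).trans (hc.1.1 k rfl).2⟩

/-- The publishing event depends only on the blocks mined so far and on what is public. -/
lemma PublishEvent.congr (hT : T.IsSevere) (hmined : X.mined = X'.mined)
    (hparent : ∀ k, T.time k ≤ s → X.parent k = X'.parent k)
    (htx : ∀ k ∈ X.hasTx, T.time k ≤ s → k ∈ X'.hasTx)
    (hpublic : ∀ b, X'.Public s b → X.Public s b) (hg : X.MinedBy τ g)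
    (h : X.PublishEvent κ g s) : X'.PublishEvent κ g s := by
  obtain ⟨n₀, hn₀, hns₀⟩ := h.exists_hasTx_time_le hT
  have hτs : τ < s := (X.hasTx_mined n₀ hn₀).2.trans_le hns₀
  obtain ⟨n, hn, c, p, ⟨⟨hcm, hct⟩, hnc, hκ⟩, hp, hcp⟩ := h
  have hpar : ∀ k < T.indexAfter s, X.parent k = X'.parent k :=
    fun k hk => hparent k (hT.lt_indexAfter.1 hk)
  have hh : ∀ b : Block, (∀ k, b = some k → T.time k ≤ s) → X.height b = X'.height b :=
    fun b hb => BlockTree.height_congr hpar b fun k hk => hT.lt_indexAfter.2 (hb k hk)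
  have hps : ∀ k, p = some k → T.time k ≤ s := by
    rcases hp with ⟨-, rfl⟩ | ⟨k, hk, rfl⟩
    · exact fun k hk => ((hg k hk).2.trans hτs.le)
    · intro l hl
      obtain rfl := Option.some.inj hl
      exact hk.1.2
  have hcs : ∀ k, c = some k → T.time k ≤ s := fun k hk => (hcm k hk).2
  have hns : T.time n ≤ s := (hcm.of_onChain hT hnc n rfl).2
  refine ⟨n, htx n hn hns, c, p, ⟨⟨fun k hk => ⟨hmined ▸ (hcm k hk).1, hcs k hk⟩, fun b hb => ?_⟩,
    hnc.congr hpar fun k hk => hT.lt_indexAfter.2 (hcs k hk), ?_⟩, hp, ?_⟩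
  · rw [← hh c hcs, ← hh b fun k hk => (hb.minedBy hT k hk).2]
    exact hct b (hpublic b hb)
  · rwa [← hh c hcs, ← hh (some n) fun k hk => by rwa [← Option.some.inj hk]]
  · rwa [← hh c hcs, ← hh p hps]

/-- If the publishing event occurs, then it already occurs when some block is mined. -/
lemma PublishEvent.exists_index (hT : T.IsSevere) (h : X.PublishEvent κ g s) :
    ∃ n, T.time n ≤ s ∧ X.PublishEvent κ g (T.time n) := by
  obtain ⟨n, hn, c, p, ⟨⟨hcm, hct⟩, hnc, hκ⟩, hp, hcp⟩ := h
  obtain ⟨k, rfl, hnk⟩ := hnc.exists_index_le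
  -- The event occurs as soon as both the confirming chain and the private chain are complete.
  obtain ⟨l, hls, hkl, hpl⟩ : ∃ l, T.time l ≤ s ∧ k ≤ l ∧ T.PrivateTipAt τ g (T.time l) p := by
    rcases hp with ⟨he, rfl⟩ | ⟨r, hr, rfl⟩
    · refine ⟨k, (hcm k rfl).2, le_rfl, .inl ⟨Set.eq_empty_of_forall_notMem fun r hr => ?_, rfl⟩⟩
      exact Set.eq_empty_iff_forall_notMem.1 he r ⟨hr.1, hr.2.trans (hcm k rfl).2⟩
    · have hs : T.time (max k r) ≤ s := by
        rcases max_choice k r with h | h <;> rw [h]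
        exacts [(hcm k rfl).2, hr.1.2]
      exact ⟨max k r, hs, le_max_left _ _, .inr ⟨r,
        ⟨⟨hr.1.1, hT.time_strictMono.monotone (le_max_right _ _)⟩,
          fun q hq => hr.2 ⟨hq.1, hq.2.trans hs⟩⟩, rfl⟩⟩
  refine ⟨l, hls, n, hn, some k, p, ⟨⟨fun q hq => ?_, fun b hb => hct b fun j hj =>
    X.view_mono j hj _ _ hls (hb j hj)⟩, hnc, hκ⟩, hpl, hcp⟩
  obtain rfl := Option.some.inj hq
  exact ⟨(hcm k rfl).1, hT.time_strictMono.monotone hkl⟩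

/-- Private-mining executions exist.  The publishing event is read off from the execution in which
nothing is ever published; the execution in which everything becomes public after that event agrees
with it until then. -/
theorem exists_isPrivateMining (hT : T.IsSevere) (τ : ℝ) (κ : ℕ) :
    ∃ Y : Execution T τ, Y.IsPrivateMining κ := by
  set Z : Execution T τ := Trace.privateExecution hT (Q := ∅) isUpperSet_empty (by simp) with hZ
  set Q : Set ℝ := {t | ∃ s < t, Z.PublishEvent κ (T.raceStart τ ∅) s} with hQdef
  have hQ : IsUpperSet Q := fun s t hst ⟨r, hr, h⟩ => ⟨r, hr.trans_le hst, h⟩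
  have hlate : ∀ t ∈ Q, ∃ n, T.IsHonest n ∧ τ < T.time n ∧ T.time n < t := by
    rintro t ⟨s, hst, h⟩
    obtain ⟨n, hn, hns⟩ := h.exists_hasTx_time_le hT
    exact ⟨n, hn.1, hn.2.1, hns.trans_lt hst⟩
  have hafter : ∀ t ∈ Q, τ < t := fun t ht => by
    obtain ⟨n, -, h1, h2⟩ := hlate t ht
    exact h1.trans h2
  have hdel : ∀ t ∈ Q, ∀ k, T.IsHonest k → T.time k ≤ τ → T.deliveryTime k ≤ t := by
    intro t ht k hk hkτ
    obtain ⟨n, hn, h1, h2⟩ := hlate t ht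
    have := hT.deliveryTime_lt k n (hT.time_strictMono.lt_iff_lt.1 (hkτ.trans_lt h1)) hk hn
    exact (this.trans h2).le
  set Y : Execution T τ := Trace.privateExecution hT hQ hdel with hYdef
  have hheight : ∀ s, s ∉ Q → ∀ k, T.time k ≤ s →
      T.privateHeight τ Q k = T.privateHeight τ ∅ k := fun s hs k hk =>
    Trace.privateHeight_congr k fun l hl => iff_of_false
      (fun h => hs (hQ ((hT.time_strictMono.monotone hl).trans hk) h)) (by simp)
  have hstart : T.raceStart τ Q = T.raceStart τ ∅ := tallest_congr fun k hk =>
    hheight τ (fun h => lt_irrefl _ (hafter τ h)) k (hT.lt_indexAfter.1 hk)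
  have hparent : ∀ s, s ∉ Q → ∀ k, T.time k ≤ s → Y.parent k = Z.parent k := fun s hs k hk =>
    Trace.privateParent_congr
      (fun l hl => hheight s hs l ((hT.time_strictMono hl).le.trans hk))
      (iff_of_false (fun h => hs (hQ hk h)) (by simp))
  have htx : ∀ s, s ∉ Q → ∀ k, T.time k ≤ s → (k ∈ Y.hasTx ↔ k ∈ Z.hasTx) := by
    intro s hs k hk
    have hp := hparent s hs k hk
    have hpar : ∀ l < T.indexAfter s, Y.parent l = Z.parent l :=
      fun l hl => hparent s hs l (hT.lt_indexAfter.1 hl)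
    have hlt : ∀ l, Y.parent k = some l → l < T.indexAfter s :=
      fun l hl => (Y.parent_lt k l hl).trans (hT.lt_indexAfter.2 hk)
    refine and_congr_right fun _ => and_congr_right fun _ => forall_congr' fun a => ?_
    refine imp_congr_left ⟨fun h => ?_, fun h => ?_⟩
    · exact hp ▸ BlockTree.OnChain.congr hpar hlt h
    · change Z.OnChain _ (Z.parent k) at h
      rw [← hp] at h
      exact BlockTree.OnChain.congr (fun l hl => (hpar l hl).symm) hlt h
  have hpublic : ∀ s, s ∉ Q → ∀ b, Y.Public s b ↔ Z.Public s b := by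
    intro s hs b
    refine forall_congr' fun j => imp_congr_right fun _ => forall_congr' fun n =>
      imp_congr_right fun _ => or_congr_right (iff_of_false (fun h => hs h.2.2) (by simp))
  have hg : Z.MinedBy τ (T.raceStart τ ∅) := fun k hk =>
    ⟨(mem_of_tallest_eq hk).1, hT.lt_indexAfter.1 (mem_of_tallest_eq hk).2⟩
  have hagree : ∀ s, s ∉ Q → (Y.PublishEvent κ (T.raceStart τ Q) s ↔
      Z.PublishEvent κ (T.raceStart τ ∅) s) := by
    intro s hs
    rw [hstart]
    exact ⟨fun h => h.congr (X := Y) (X' := Z) hT rfl (hparent s hs) (fun k hk hks => (htx s hs k hks).1 hk)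
        (fun b => (hpublic s hs b).2) hg,
      fun h => h.congr (X := Z) (X' := Y) hT rfl (fun k hk => (hparent s hs k hk).symm)
        (fun k hk hks => (htx s hs k hks).2 hk) (fun b => (hpublic s hs b).1) hg⟩
  refine ⟨Y, T.raceStart τ Q, Trace.followsPrivateMining_privateExecution hT hQ hdel hafter ?_ ?_⟩
  · rintro t ⟨s, hst, hs⟩
    classical
    have hex : ∃ n, Z.PublishEvent κ (T.raceStart τ ∅) (T.time n) :=
      (hs.exists_index hT).imp fun _ h => h.2
    obtain ⟨n, hns, hn⟩ := hs.exists_index hT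
    refine ⟨T.time (Nat.find hex), ((hT.time_strictMono.monotone
      (Nat.find_min' hex hn)).trans hns).trans_lt hst, (hagree _ ?_).2 (Nat.find_spec hex)⟩
    rintro ⟨r, hr, hrZ⟩
    obtain ⟨l, hlr, hl⟩ := hrZ.exists_index hT
    exact Nat.find_min hex (hT.time_strictMono.lt_iff_lt.1 (hlr.trans_lt hr)) hl
  · intro s t hs hst
    by_cases hsQ : s ∈ Q
    · exact hQ hst.le hsQ
    · exact ⟨s, hst, (hagree s hsQ).1 hs⟩

end Execution

/-! ### Almost sure properties of the mining process -/

lemma expMeasure_Iic_zero {r : ℝ} (hr : 0 < r) : expMeasure r (Set.Iic 0) = 0 := by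
  have := isProbabilityMeasure_expMeasure hr
  rw [← measureReal_eq_zero_iff, ← cdf_eq_real, cdf_expMeasure_eq hr]
  simp

lemma expMeasure_Ioi_one_ne_zero {r : ℝ} (hr : 0 < r) : expMeasure r (Set.Ioi 1) ≠ 0 := by
  have := isProbabilityMeasure_expMeasure hr
  rw [← Set.compl_Iic, ne_eq, prob_compl_eq_zero_iff measurableSet_Iic]
  intro h
  have h1 : cdf (expMeasure r) 1 = 1 := by rw [cdf_eq_real, measureReal_def, h]; rfl
  rw [cdf_expMeasure_eq hr, if_pos zero_le_one] at h1
  have := Real.exp_pos (-(r * 1))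
  linarith

namespace Env

variable {m N : ℕ} (E : Env m N)

lemma ae_waiting_pos : ∀ᵐ ω ∂E.powLaw, ∀ n, 0 < (ω n).1 := by
  have := isProbabilityMeasure_expMeasure E.totalRate_pos
  rw [ae_all_iff]
  intro n
  have h1 : ∀ᵐ x ∂expMeasure E.totalRate, 0 < x := by
    rw [ae_iff]
    simpa [Set.Iic] using expMeasure_Iic_zero E.totalRate_pos
  have h2 : ∀ᵐ x ∂E.stepLaw, 0 < x.1 := Measure.quasiMeasurePreserving_fst.ae h1
  exact (measurePreserving_eval_infinitePi (fun _ : ℕ => E.stepLaw) n).quasiMeasurePreserving.ae h2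

lemma ae_frequently_mem {A : Set (ℝ × Mark N)} (hA : MeasurableSet A) (h0 : E.stepLaw A ≠ 0) :
    ∀ᵐ ω ∂E.powLaw, ∃ᶠ n in Filter.atTop, ω n ∈ A := by
  have hprob : IsProbabilityMeasure E.powLaw := by unfold powLaw; infer_instance
  have hind : iIndepFun (fun (n : ℕ) (ω : Sample N) => ω n) E.powLaw :=
    iIndepFun_infinitePi (X := fun _ x => x) (fun _ => measurable_id)
  have hmeas : ∀ n : ℕ, MeasurableSet ((fun ω : Sample N => ω n) ⁻¹' A) :=
    fun n => measurable_pi_apply n hA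
  have hset : iIndepSet (fun n : ℕ => (fun ω : Sample N => ω n) ⁻¹' A) E.powLaw :=
    (iIndepSet_iff_meas_biInter hmeas).2 fun s =>
      hind.measure_inter_preimage_eq_mul s (sets := fun _ => A) fun _ _ => hA
  have hval : ∀ n : ℕ, E.powLaw ((fun ω : Sample N => ω n) ⁻¹' A) = E.stepLaw A := fun n =>
    (measurePreserving_eval_infinitePi (fun _ : ℕ => E.stepLaw) n).measure_preimage
      hA.nullMeasurableSet
  have hlim := measure_limsup_eq_one hmeas hset (by
    simp_rw [hval]
    exact ENNReal.tsum_const_eq_top_of_ne_zero h0)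
  have hae := (prob_compl_eq_zero_iff (MeasurableSet.measurableSet_limsup hmeas)).2 hlim
  filter_upwards [compl_mem_ae_iff.2 hae] with ω hω
  rw [compl_compl, Filter.mem_limsup_iff_frequently_mem] at hω
  exact hω

lemma ae_frequently_honest (i : Fin m) : ∀ᵐ ω ∂E.powLaw, ∃ᶠ n in Filter.atTop,
    1 < (ω n).1 ∧ E.shard (ω n).2.1 = i ∧ E.honest (ω n).2.1 := by
  obtain ⟨p, hpi, hph⟩ := E.honest_presence i
  have := isProbabilityMeasure_expMeasure E.totalRate_pos
  have h0 : E.stepLaw (Set.Ioi 1 ×ˢ {(p, false)}) ≠ 0 := by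
    rw [stepLaw, Measure.prod_prod]
    refine mul_ne_zero (expMeasure_Ioi_one_ne_zero E.totalRate_pos) ?_
    rw [PMF.toMeasure_apply_singleton _ _ (measurableSet_singleton _), ← PMF.mem_support_iff,
      markLaw, PMF.mem_support_normalize_iff]
    refine (ENNReal.ofReal_pos.2 ?_).ne'
    simpa [markRate] using mul_pos (E.share_pos p) (E.rateExcl_pos (E.shard p))
  filter_upwards [E.ae_frequently_mem (measurableSet_Ioi.prod (measurableSet_singleton _)) h0]
    with ω hω
  refine hω.mono fun n hn => ?_
  obtain ⟨h1, h2⟩ := hn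
  rw [Set.mem_singleton_iff] at h2
  rw [h2]
  exact ⟨h1, hpi, hph⟩

variable {E}

lemma deliveryTime_severeTrace_of_isFull {ω : Sample N} {i : Fin m} {n : ℕ}
    (h : E.IsFull ω i n) : (E.severeTrace ω i).deliveryTime n = arrivalTime ω n + E.delay i := by
  have : (E.severeTrace ω i).full n := h
  rw [Trace.deliveryTime, if_pos this]
  rfl

lemma deliveryTime_severeTrace_of_not_isFull {ω : Sample N} {i : Fin m} {n : ℕ}
    (h : ¬ E.IsFull ω i n) : (E.severeTrace ω i).deliveryTime n = arrivalTime ω n := by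
  have : ¬ (E.severeTrace ω i).full n := h
  rw [Trace.deliveryTime, if_neg this, add_zero]
  rfl

lemma severeTrace_isSevere {ω : Sample N} (hpos : ∀ n, 0 < (ω n).1) {i : Fin m}
    (hfreq : ∃ᶠ n in Filter.atTop, 1 < (ω n).1 ∧ E.shard (ω n).2.1 = i ∧ E.honest (ω n).2.1) :
    (E.severeTrace ω i).IsSevere := by
  have hmono : StrictMono (arrivalTime ω) := strictMono_nat_of_lt_succ fun n => by
    rw [arrivalTime, arrivalTime, Finset.sum_range_succ _ (n + 1)]
    linarith [hpos (n + 1)]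
  rw [Filter.frequently_atTop] at hfreq
  have hunb : ∀ K : ℕ, ∃ n, (K : ℝ) < arrivalTime ω n := by
    intro K
    induction K with
    | zero => exact ⟨0, by simpa [arrivalTime] using hpos 0⟩
    | succ K ih =>
      obtain ⟨n, hn⟩ := ih
      obtain ⟨l, hl, hl1, -⟩ := hfreq (n + 1)
      obtain ⟨q, rfl⟩ : ∃ q, l = q + 1 := ⟨l - 1, by omega⟩
      refine ⟨q + 1, ?_⟩
      have := hmono.monotone (by omega : n ≤ q)
      have hs : arrivalTime ω (q + 1) = arrivalTime ω q + (ω (q + 1)).1 :=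
        Finset.sum_range_succ _ _
      rw [hs]
      push_cast
      linarith
  have hunb' : ∀ t, ∃ n, t < arrivalTime ω n := fun t => by
    obtain ⟨K, hK⟩ := exists_nat_gt t
    obtain ⟨n, hn⟩ := hunb K
    exact ⟨n, hK.trans hn⟩
  refine ⟨hmono, hunb', fun n => ?_, fun k n hkn hk hn => ?_, fun K => ?_⟩
  · have := E.delay_nonneg i
    by_cases hf : E.IsFull ω i n
    · rw [deliveryTime_severeTrace_of_isFull hf]
      change arrivalTime ω n ≤ _
      linarith
    · exact (deliveryTime_severeTrace_of_not_isFull hf).ge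
  · obtain ⟨hl, hh⟩ := hn
    change E.SevereLive ω i n at hl
    rw [SevereLive] at hl
    by_cases hf : E.IsFull ω i k
    · rw [deliveryTime_severeTrace_of_isFull hf]
      exact hl.2.2 hh k hkn hk.1 hk.2 hf
    · rw [deliveryTime_severeTrace_of_not_isFull hf]
      exact hmono hkn
  -- If there were no honest blocks from some index on, no delivery would void later solutions.
  · by_contra! hno
    obtain ⟨M, hM⟩ := hunb' (arrivalTime ω K + E.delay i)
    obtain ⟨n, hn, -, hni, hnh⟩ := hfreq (max K M)
    refine hno n ((le_max_left _ _).trans hn) ⟨?_, hnh⟩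
    change E.SevereLive ω i n
    rw [SevereLive]
    refine ⟨.inl hni, fun k hk _ => (hmono hk).ne, fun _ k _ hk hkh _ => ?_⟩
    have hkK : k < K := by
      by_contra h
      exact hno k (not_lt.1 h) ⟨hk, hkh⟩
    have h1 := hmono hkK
    have h2 := hmono.monotone ((le_max_right _ _).trans hn)
    linarith

end Env

theorem mainTheorem5 {m N : ℕ} (E : Env m N) :
    ∀ᵐ ω ∂E.powLaw, ∀ (i : Fin m) (τ : ℝ) (κ : ℕ), 1 ≤ κ →
      (∃ X : Execution (E.severeTrace ω i) τ, X.ViolatesConsistency κ) →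
        (∃ Y : Execution (E.severeTrace ω i) τ, Y.IsPrivateMining κ) ∧
          ∀ Y : Execution (E.severeTrace ω i) τ,
            Y.IsPrivateMining κ → Y.ViolatesConsistency κ := by
  filter_upwards [E.ae_waiting_pos, ae_all_iff.2 E.ae_frequently_honest]
    with ω hpos hfreq i τ κ hκ ⟨X, hX⟩
  have hT := Env.severeTrace_isSevere hpos (hfreq i)
  refine ⟨Execution.exists_isPrivateMining hT τ κ, fun Y ⟨g, hY⟩ => ?_⟩
  obtain ⟨s, h1, h2⟩ := hX.exists_race_bounds hT hκ
  obtain ⟨s', hs'⟩ := hY.exists_publishEvent hT hκ h1 h2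
  exact hY.violatesConsistency_of_publishEvent hT hs'
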